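/- Let $Y$ be a complex manifold with structure sheaf $\mathcal O_Y$, let $\imath\colon X\hookrightarrow Y$ be a compact complex submanifold with ideal sheaf $\mathcal I$, and let $X_1=(X,\mathcal O_Y/\mathcal I^2)$ be its first infinitesimal neighbourhood. Write $\Omega^1_{Y|X}$ for the restriction to $X$ of the cotangent bundle of $Y$ and $\mathcal N^*_{X/Y}\subset\Omega^1_{Y|X}$ for the conormal bundle, consisting of the covectors that vanish on $T_X$. Let $E\to X$ be a holomorphic vector bundle of rank $r$. An extension of $E$ is a vector bundle $E_1\to X_1$ together with an identification $\imath^*E_1= E$; an isomorphism of extensions is an isomorphism of vector bundles over $X_1$ which induces the identity of $E$. Let $\mathcal C(E)$ be the set of isomorphism classes of extensions, and assume $\mathcal C(E)\ne\emptyset$. For an open cover $\{U_i\}$ of $X$ and frames of $E$ over the $U_i$ with transition functions $g_{ij}$, an extension which is trivialized over the $U_i$ compatibly with these frames has transition functions $G_{ij}\in GL_r\big((\mathcal O_Y/\mathcal I^2)(U_i\cap U_j)\big)$ with $G_{ij}|_X=g_{ij}$. Let $\Delta_{ij}=dG_{ij}$, a matrix of sections of $\Omega^1_{Y|X}$ over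 $U_i\cap U_j$. A section of $\mathrm{End}(E)$, possibly with coefficients in $\Omega^1_{Y|X}$, is given by its matrices $m_\lambda$ in the frames over the $U_\lambda$. The Atiyah class $\mathrm{At}(E_1)\in H^1(X,\Omega^1_{Y|X}\otimes\mathrm{End}(E))$ is the class of the cocycle $g_{\lambda i}\Delta_{i\lambda}-g_{\lambda j}\Delta_{j\lambda}$. For $e\in\mathcal C(E)$ with data $(g_{ij},\Delta_{ij})$ and $\gamma\in H^1(X,\mathcal N^*_{X/Y}\otimes\mathrm{End}(E))$ represented by a cocycle $C_{ij}$ on the same (sufficiently fine) cover, $e+\gamma\in\mathcal C(E)$ is the class of the extension with data $(g_{ij},\Delta'_{ij})$, where $\Delta'_{ij}=\Delta_{ij}+g_{i\lambda}C_{ij}g_{\lambda j}$. Then $\mathrm{At}$ is a well-defined map $\mathcal C(E)\to H^1(X,\Omega^1_{Y|X}\otimes\mathrm{End}(E))$, $e+\gamma$ is well defined, and for every fixed $e\in\mathcal C(E)$ the map $$H^1(X,\mathcal N^*_{X/Y}\otimes\mathrm{End}(E))\to\mathcal C(E),\qquad \gamma\mapsto e+\gamma,$$ is a bijection. Moreover,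 for every $\gamma$, the difference $\mathrm{At}(e+\gamma)-\mathrm{At}(e)$ is the image of $\gamma$ under the natural map $H^1(X,\mathcal N^*_{X/Y}\otimes\mathrm{End}(E))\to H^1(X,\Omega^1_{Y|X}\otimes\mathrm{End}(E))$ induced by the inclusion $\mathcal N^*_{X/Y}\subset\Omega^1_{Y|X}$. -/

import Mathlib

open scoped Manifold ContDiff Topology Bundle
open TopologicalSpace Bundle

noncomputable section

namespace FirstOrderExtension

/-! ### First Čech cohomology of a sheaf of families -/

section Cech

variable {X : Type*} [TopologicalSpace X]

/-- An open cover of `X`, presented as the choice of an open neighbourhood of every point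
(every open cover is refined by one of this kind). -/
structure PointCover (X : Type*) [TopologicalSpace X] where
  nhd : X → Opens X
  mem_nhd : ∀ x, x ∈ nhd x

/-- `W.Refines U` : the cover `W` is finer than `U`. -/
def PointCover.Refines (W U : PointCover X) : Prop := ∀ a, W.nhd a ≤ U.nhd a

/-- Common refinement. -/
def PointCover.inf (U V : PointCover X) : PointCover X where
  nhd a := U.nhd a ⊓ V.nhd a
  mem_nhd a := ⟨U.mem_nhd a, V.mem_nhd a⟩

variable {A : X → Type*} [∀ x, AddCommGroup (A x)]

/-- A sheaf of families of elements of the groups `A x` is given by the groups `S x` of those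
families which are sections of it near `x`. A section over an open set `U` is represented by a
family whose restriction to `U` is one; its values off `U` are irrelevant. -/
def sectionsOver (S : X → AddSubgroup (∀ x, A x)) (U : Opens X) : AddSubgroup (∀ x, A x) :=
  ⨅ x ∈ U, S x

theorem mem_sectionsOver {S : X → AddSubgroup (∀ x, A x)} {U : Opens X} {s : ∀ x, A x} :
    s ∈ sectionsOver S U ↔ ∀ x ∈ U, s ∈ S x := by
  simp [sectionsOver, AddSubgroup.mem_iInf]

/-- Čech 1-cocycles on the cover `U`: sections `c a b` over `U_a ∩ U_b` with
`c_ab + c_bc = c_ac` on triple intersections. -/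
def cocycles (S : X → AddSubgroup (∀ x, A x)) (U : PointCover X) :
    AddSubgroup (X → X → ∀ x, A x) where
  carrier := {c | (∀ a b, c a b ∈ sectionsOver S (U.nhd a ⊓ U.nhd b)) ∧
    ∀ a b d, ∀ x ∈ U.nhd a ⊓ U.nhd b ⊓ U.nhd d, c a b x + c b d x = c a d x}
  zero_mem' := ⟨fun _ _ => zero_mem _, by simp⟩
  add_mem' := by
    rintro c c' ⟨h, k⟩ ⟨h', k'⟩
    refine ⟨fun a b => add_mem (h a b) (h' a b), fun a b d x hx => ?_⟩
    simp only [Pi.add_apply, ← k a b d x hx, ← k' a b d x hx]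
    abel
  neg_mem' := by
    rintro c ⟨h, k⟩
    refine ⟨fun a b => neg_mem (h a b), fun a b d x hx => ?_⟩
    simp only [Pi.neg_apply, ← k a b d x hx]
    abel

/-- Čech 1-coboundaries on the cover `U`: `c_ab = s_a - s_b` on `U_a ∩ U_b`, where `s_a` is a
section over `U_a`. -/
def coboundaries (S : X → AddSubgroup (∀ x, A x)) (U : PointCover X) :
    AddSubgroup (X → X → ∀ x, A x) where
  carrier := {c | ∃ s : X → ∀ x, A x, (∀ a, s a ∈ sectionsOver S (U.nhd a)) ∧
    ∀ a b, ∀ x ∈ U.nhd a ⊓ U.nhd b, c a b x = s a x - s b x}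
  zero_mem' := ⟨0, fun _ => zero_mem _, by simp⟩
  add_mem' := by
    rintro c c' ⟨s, h, k⟩ ⟨s', h', k'⟩
    refine ⟨s + s', fun a => add_mem (h a) (h' a), fun a b x hx => ?_⟩
    simp only [Pi.add_apply, k a b x hx, k' a b x hx]
    abel
  neg_mem' := by
    rintro c ⟨s, h, k⟩
    refine ⟨-s, fun a => neg_mem (h a), fun a b x hx => ?_⟩
    simp only [Pi.neg_apply, k a b x hx]
    abel

theorem sectionsOver_anti {S : X → AddSubgroup (∀ x, A x)} {U V : Opens X} (h : V ≤ U) :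
    sectionsOver S U ≤ sectionsOver S V := fun _ hs =>
  mem_sectionsOver.2 fun x hx => mem_sectionsOver.1 hs x (h hx)

theorem cocycles_anti {S : X → AddSubgroup (∀ x, A x)} {U W : PointCover X} (h : W.Refines U) :
    cocycles S U ≤ cocycles S W := fun _ hc =>
  ⟨fun a b => sectionsOver_anti (inf_le_inf (h a) (h b)) (hc.1 a b),
    fun a b d x hx => hc.2 a b d x ⟨⟨h a hx.1.1, h b hx.1.2⟩, h d hx.2⟩⟩

theorem coboundaries_anti {S : X → AddSubgroup (∀ x, A x)} {U W : PointCover X}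
    (h : W.Refines U) : coboundaries S U ≤ coboundaries S W := by
  rintro c ⟨s, hs, k⟩
  exact ⟨s, fun a => sectionsOver_anti (h a) (hs a),
    fun a b x hx => k a b x ⟨h a hx.1, h b hx.2⟩⟩

theorem PointCover.inf_left (U V : PointCover X) : (U.inf V).Refines U := fun _ => inf_le_left
theorem PointCover.inf_right (U V : PointCover X) : (U.inf V).Refines V := fun _ => inf_le_right

/-- Cocycles on some open cover. Refining the cover does not change the representing families,
so that the direct limit over all covers is a union. -/
def allCocycles (S : X → AddSubgroup (∀ x, A x)) : AddSubgroup (X → X → ∀ x, A x) where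
  carrier := {c | ∃ U : PointCover X, c ∈ cocycles S U}
  zero_mem' := ⟨⟨fun _ => ⊤, fun _ => trivial⟩, zero_mem _⟩
  add_mem' := by
    rintro c c' ⟨U, h⟩ ⟨V, k⟩
    exact ⟨U.inf V, add_mem (cocycles_anti (U.inf_left V) h) (cocycles_anti (U.inf_right V) k)⟩
  neg_mem' := by
    rintro c ⟨U, h⟩
    exact ⟨U, neg_mem h⟩

/-- Coboundaries on some open cover. Families which vanish on all intersections `U_a ∩ U_b` are
among them, so that only the values there count in the quotient. -/
def allCoboundaries (S : X → AddSubgroup (∀ x, A x)) : AddSubgroup (X → X → ∀ x, A x) where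
  carrier := {c | ∃ U : PointCover X, c ∈ coboundaries S U}
  zero_mem' := ⟨⟨fun _ => ⊤, fun _ => trivial⟩, zero_mem _⟩
  add_mem' := by
    rintro c c' ⟨U, h⟩ ⟨V, k⟩
    exact ⟨U.inf V,
      add_mem (coboundaries_anti (U.inf_left V) h) (coboundaries_anti (U.inf_right V) k)⟩
  neg_mem' := by
    rintro c ⟨U, h⟩
    exact ⟨U, neg_mem h⟩

/-- The Čech cohomology group `H¹(X, S)`: the direct limit over all open covers of the groups of
1-cocycles modulo 1-coboundaries. -/
def H1 (S : X → AddSubgroup (∀ x, A x)) : Type _ :=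
  allCocycles S ⧸ (allCoboundaries S).addSubgroupOf (allCocycles S)

instance (S : X → AddSubgroup (∀ x, A x)) : AddCommGroup (H1 S) :=
  inferInstanceAs (AddCommGroup (_ ⧸ (allCoboundaries S).addSubgroupOf (allCocycles S)))

/-- The cohomology class of a cocycle on the cover `U`. -/
def H1.mk {S : X → AddSubgroup (∀ x, A x)} {U : PointCover X} (c : cocycles S U) : H1 S :=
  QuotientAddGroup.mk ⟨c.1, U, c.2⟩

theorem cocycles_mono {S T : X → AddSubgroup (∀ x, A x)} (h : ∀ x, S x ≤ T x)
    (U : PointCover X) : cocycles S U ≤ cocycles T U := fun _ hc =>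
  ⟨fun a b => mem_sectionsOver.2 fun x hx => h x (mem_sectionsOver.1 (hc.1 a b) x hx), hc.2⟩

/-- The map `H¹(X, S) → H¹(X, T)` induced by the inclusion of a subsheaf `S` of `T`. -/
def H1.map {S T : X → AddSubgroup (∀ x, A x)} (h : ∀ x, S x ≤ T x) : H1 S →+ H1 T :=
  QuotientAddGroup.map _ _
    (AddSubgroup.inclusion fun _ ⟨U, hc⟩ => ⟨U, cocycles_mono h U hc⟩) <| by
      rintro ⟨c, _⟩ ⟨U, s, hs, k⟩
      exact ⟨U, s, fun a => mem_sectionsOver.2 fun x hx => h x (mem_sectionsOver.1 (hs a) x hx), k⟩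

end Cech

/-! ### The structure sheaf of the first infinitesimal neighbourhood -/

section Thickening

variable {EX EY : Type*} [NormedAddCommGroup EX] [NormedSpace ℂ EX]
  [NormedAddCommGroup EY] [NormedSpace ℂ EY]
  {X Y : Type*} [TopologicalSpace X] [ChartedSpace EX X] [TopologicalSpace Y] [ChartedSpace EY Y]

variable (EY) in
/-- The ring of functions on `Y` which are holomorphic in a neighbourhood of `y`. -/
def holomorphicAt (y : Y) : Subring (Y → ℂ) where
  carrier := {F | ContMDiffAt 𝓘(ℂ, EY) 𝓘(ℂ) ω F y}
  mul_mem' hF hG := ContMDiffAt.mul hF hG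
  one_mem' := contMDiffAt_const
  add_mem' hF hG := ContMDiffAt.add hF hG
  zero_mem' := contMDiffAt_const
  neg_mem' hF := ContMDiffAt.neg hF

variable (ι : C^ω⟮𝓘(ℂ, EX), X; 𝓘(ℂ, EY), Y⟯)

/-- The ideal of `X` at the point `x`: functions holomorphic near `ι x` and vanishing on `X`
near `x`. -/
def idealAt (x : X) : Ideal (holomorphicAt EY (ι x)) where
  carrier := {F | ∀ᶠ z in 𝓝 x, F.1 (ι z) = 0}
  add_mem' hF hG := by
    filter_upwards [hF, hG] with z h k
    simp [h, k]
  zero_mem' := by simp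
  smul_mem' c F hF := by
    filter_upwards [hF] with z h
    simp [h]

/-- The stalk at `x` of the structure sheaf `𝒪_Y / ℐ²` of the first infinitesimal neighbourhood
`X₁` of `X` in `Y`. (A function which vanishes near `ι x` lies in the square of the ideal, so that
this is the quotient of the ring of germs.) -/
abbrev Stalk (x : X) : Type _ := holomorphicAt EY (ι x) ⧸ (idealAt ι x) ^ 2

/-- The families of elements of the stalks which are sections of `𝒪_Y / ℐ²` near `x`, that is,
which are induced near `x` by one holomorphic function on `Y`. -/
def regularAt (x : X) : Subring (∀ z, Stalk ι z) where
  carrier := {s | ∃ F : Y → ℂ, ∀ᶠ z in 𝓝 x, ∃ h : F ∈ holomorphicAt EY (ι z),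
    s z = Ideal.Quotient.mk _ ⟨F, h⟩}
  mul_mem' := by
    rintro s t ⟨F, hF⟩ ⟨G, hG⟩
    refine ⟨F * G, ?_⟩
    filter_upwards [hF, hG] with z ⟨h, e⟩ ⟨k, e'⟩
    exact ⟨mul_mem h k, by rw [Pi.mul_apply, e, e', ← map_mul]; rfl⟩
  one_mem' := ⟨1, .of_forall fun z => ⟨one_mem _, rfl⟩⟩
  add_mem' := by
    rintro s t ⟨F, hF⟩ ⟨G, hG⟩
    refine ⟨F + G, ?_⟩
    filter_upwards [hF, hG] with z ⟨h, e⟩ ⟨k, e'⟩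
    exact ⟨add_mem h k, by rw [Pi.add_apply, e, e', ← map_add]; rfl⟩
  zero_mem' := ⟨0, .of_forall fun z => ⟨zero_mem _, rfl⟩⟩
  neg_mem' := by
    rintro s ⟨F, hF⟩
    refine ⟨-F, ?_⟩
    filter_upwards [hF] with z ⟨h, e⟩
    exact ⟨neg_mem h, by rw [Pi.neg_apply, e, ← map_neg]; rfl⟩

theorem eval_eq_zero {x : X} {F : holomorphicAt EY (ι x)} (hF : F ∈ idealAt ι x) :
    F.1 (ι x) = 0 :=
  Filter.Eventually.self_of_nhds (p := fun z => F.1 (ι z) = 0) hF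

/-- The value at `x` of an element of the stalk; on sections this is the restriction
`𝒪_{X₁} → 𝒪_X`. -/
def value (x : X) : Stalk ι x →+* ℂ :=
  Ideal.Quotient.lift _ ((Pi.evalRingHom (fun _ : Y => ℂ) (ι x)).comp
    (holomorphicAt EY (ι x)).subtype) fun _ hF => eval_eq_zero ι (Ideal.pow_le_self two_ne_zero hF)

theorem mdifferentiableAt_of_mem {y : Y} (F : holomorphicAt EY y) :
    MDifferentiableAt 𝓘(ℂ, EY) 𝓘(ℂ) F.1 y :=
  ContMDiffAt.mdifferentiableAt F.2 (by simp)

theorem mfderiv_eq_zero {x : X} {F : holomorphicAt EY (ι x)} (hF : F ∈ (idealAt ι x) ^ 2) :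
    mfderiv 𝓘(ℂ, EY) 𝓘(ℂ) F.1 (ι x) = 0 := by
  rw [pow_two] at hF
  refine Submodule.mul_induction_on hF (fun F hF G hG => ?_) (fun F G hF hG => ?_)
  · have h := (mdifferentiableAt_of_mem F).hasMFDerivAt.mul
      (mdifferentiableAt_of_mem G).hasMFDerivAt
    rw [eval_eq_zero ι hF, eval_eq_zero ι hG] at h
    refine h.mfderiv.trans ?_
    ext v
    change (0 : ℂ) * _ + (0 : ℂ) * _ = 0
    ring
  · have h := (mdifferentiableAt_of_mem F).hasMFDerivAt.add
      (mdifferentiableAt_of_mem G).hasMFDerivAt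
    rw [hF, hG] at h
    exact h.mfderiv.trans (add_zero _)

/-- The differential at `ι x` of an element of the stalk of `𝒪_Y / ℐ²` at `x`, a covector of `Y`;
on sections this is the map `d : 𝒪_{X₁} → Ω¹_{Y|X}`. -/
def differential (x : X) (s : Stalk ι x) : TangentSpace 𝓘(ℂ, EY) (ι x) →L[ℂ] ℂ :=
  Quotient.liftOn' s (fun F => mfderiv 𝓘(ℂ, EY) 𝓘(ℂ) F.1 (ι x)) <| by
    intro F G h
    have h0 := mfderiv_eq_zero ι ((Submodule.quotientRel_def _).1 h)
    have h1 := (mdifferentiableAt_of_mem F).hasMFDerivAt.sub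
      (mdifferentiableAt_of_mem G).hasMFDerivAt
    exact sub_eq_zero.1 (h1.mfderiv.symm.trans h0)

end Thickening

/-! ### Vector bundles on the first infinitesimal neighbourhood -/

section ThickBundle

variable {EX EY : Type*} [NormedAddCommGroup EX] [NormedSpace ℂ EX]
  [NormedAddCommGroup EY] [NormedSpace ℂ EY]
  {X Y : Type*} [TopologicalSpace X] [ChartedSpace EX X] [TopologicalSpace Y] [ChartedSpace EY Y]
  (ι : C^ω⟮𝓘(ℂ, EX), X; 𝓘(ℂ, EY), Y⟯) (r : ℕ)

/-- A vector bundle of rank `r` on `X₁`, given by transition functions `G_ab` in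
`GL_r(𝒪_{X₁}(U_a ∩ U_b))` for an open cover `U` of `X`. Only their values on `U_a ∩ U_b` matter. -/
structure ThickBundle where
  cover : PointCover X
  trans : X → X → ∀ x, Matrix (Fin r) (Fin r) (Stalk ι x)
  regular : ∀ a b, ∀ x ∈ cover.nhd a ⊓ cover.nhd b, ∀ i j,
    (fun z => trans a b z i j) ∈ regularAt ι x
  trans_self : ∀ a, ∀ x ∈ cover.nhd a, trans a a x = 1
  trans_mul : ∀ a b c, ∀ x ∈ cover.nhd a ⊓ cover.nhd b ⊓ cover.nhd c,
    trans a b x * trans b c x = trans a c x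

variable {ι r} in
/-- The matrix `g_ab` of the restriction of a vector bundle on `X₁` to `X`. -/
def ThickBundle.g (P : ThickBundle ι r) (a b x : X) : Matrix (Fin r) (Fin r) ℂ :=
  (P.trans a b x).map (value ι x)

variable {ι r} in
/-- The matrix-valued form `Δ_ab` on `Y` along `X`, the differential of `G_ab`, evaluated on a
tangent vector of `Y`. -/
def ThickBundle.Δ (P : ThickBundle ι r) (a b x : X) (v : TangentSpace 𝓘(ℂ, EY) (ι x)) :
    Matrix (Fin r) (Fin r) ℂ :=
  (P.trans a b x).map fun s => differential ι x s v

variable {ι r}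

theorem regular_mul {x : X} {H K : ∀ z, Matrix (Fin r) (Fin r) (Stalk ι z)}
    (hH : ∀ i j, (fun z => H z i j) ∈ regularAt ι x)
    (hK : ∀ i j, (fun z => K z i j) ∈ regularAt ι x) (i j : Fin r) :
    (fun z => (H z * K z) i j) ∈ regularAt ι x := by
  have h : (fun z => (H z * K z) i j) = ∑ k, (fun z => H z i k) * fun z => K z k j := by
    ext1 z
    simp [Matrix.mul_apply]
  rw [h]
  exact sum_mem fun k _ => mul_mem (hH i k) (hK k j)

theorem regular_one {x : X} (i j : Fin r) :
    (fun z => (1 : Matrix (Fin r) (Fin r) (Stalk ι z)) i j) ∈ regularAt ι x := by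
  by_cases h : i = j
  · subst h
    simp only [Matrix.one_apply_eq]
    exact one_mem (regularAt ι x)
  · simp only [Matrix.one_apply_ne h]
    exact zero_mem (regularAt ι x)

end ThickBundle

section Frames

variable {V : Type*} [AddCommGroup V] [Module ℂ V] [TopologicalSpace V] {r : ℕ}

/-- The matrix of an endomorphism from the frame `ψ` to the frame `φ`. -/
def matrixIn (φ ψ : V ≃L[ℂ] (Fin r → ℂ)) (T : V →L[ℂ] V) :
    Matrix (Fin r) (Fin r) ℂ :=
  LinearMap.toMatrix' (φ.toLinearMap ∘ₗ T.toLinearMap ∘ₗ ψ.symm.toLinearMap)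

theorem matrixIn_self (φ : V ≃L[ℂ] (Fin r → ℂ)) : matrixIn φ φ (.id ℂ V) = 1 := by
  rw [matrixIn, ← LinearMap.toMatrix'_id]
  congr 1
  ext1 v
  simp

theorem matrixIn_mul (φ ψ χ : V ≃L[ℂ] (Fin r → ℂ)) :
    matrixIn φ ψ (.id ℂ V) * matrixIn ψ χ (.id ℂ V) = matrixIn φ χ (.id ℂ V) := by
  rw [matrixIn, matrixIn, ← LinearMap.toMatrix'_comp, matrixIn]
  congr 1
  refine LinearMap.ext fun v => ?_
  simp

end Frames

/-! ### Extensions of a vector bundle to the first infinitesimal neighbourhood -/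

section Extension

variable {EX EY : Type*} [NormedAddCommGroup EX] [NormedSpace ℂ EX]
  [NormedAddCommGroup EY] [NormedSpace ℂ EY]
  {X Y : Type*} [TopologicalSpace X] [ChartedSpace EX X] [TopologicalSpace Y] [ChartedSpace EY Y]
  (ι : C^ω⟮𝓘(ℂ, EX), X; 𝓘(ℂ, EY), Y⟯) (r : ℕ)
  (E : X → Type*) [∀ x, AddCommGroup (E x)] [∀ x, Module ℂ (E x)] [∀ x, TopologicalSpace (E x)]
  [TopologicalSpace (TotalSpace (Fin r → ℂ) E)] [FiberBundle (Fin r → ℂ) E]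

/-- An extension of `E` to `X₁` : a vector bundle `E₁` on `X₁` together with an identification of
its restriction to `X` with `E`. In terms of transition functions, the identification is given by
holomorphic frames of `E` over the sets `U_a` whose transition functions are the `g_ab`. -/
structure Extension extends ThickBundle ι r where
  frame : X → ∀ x, E x ≃L[ℂ] (Fin r → ℂ)
  frame_holomorphic : ∀ a, ∀ x ∈ cover.nhd a, ∀ w : Fin r → ℂ,
    ContMDiffAt 𝓘(ℂ, EX) (𝓘(ℂ, EX).prod 𝓘(ℂ, Fin r → ℂ)) ω
      (fun z => TotalSpace.mk' (Fin r → ℂ) z ((frame a z).symm w)) x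
  g_eq : ∀ a b, ∀ x ∈ cover.nhd a ⊓ cover.nhd b,
    toThickBundle.g a b x = matrixIn (frame a x) (frame b x) (.id ℂ (E x))

variable {ι r E}

/-- The extensions `P` and `Q` of `E` are isomorphic: there is an isomorphism `Q → P` of vector
bundles on `X₁` which restricts to the identity of `E` on `X`. It is given by invertible matrices
`H_a` over `𝒪_{X₁}` (with inverses `K_a`) on a common refinement of the covers. -/
def Extension.Isomorphic (P Q : Extension ι r E) : Prop :=
  ∃ (W : PointCover X) (H K : X → ∀ x, Matrix (Fin r) (Fin r) (Stalk ι x)),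
    W.Refines P.cover ∧ W.Refines Q.cover ∧
    (∀ a, ∀ x ∈ W.nhd a, ∀ i j, (fun z => H a z i j) ∈ regularAt ι x) ∧
    (∀ a, ∀ x ∈ W.nhd a, ∀ i j, (fun z => K a z i j) ∈ regularAt ι x) ∧
    (∀ a, ∀ x ∈ W.nhd a, H a x * K a x = 1 ∧ K a x * H a x = 1) ∧
    (∀ a b, ∀ x ∈ W.nhd a ⊓ W.nhd b, P.trans a b x * H b x = H a x * Q.trans a b x) ∧
    (∀ a, ∀ x ∈ W.nhd a,
      (H a x).map (value ι x) = matrixIn (P.frame a x) (Q.frame a x) (.id ℂ (E x)))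

theorem Extension.Isomorphic.refl (P : Extension ι r E) : P.Isomorphic P :=
  ⟨P.cover, fun _ _ => 1, fun _ _ => 1, fun _ => le_rfl, fun _ => le_rfl,
    fun _ _ _ => regular_one, fun _ _ _ => regular_one, by simp, by simp,
    fun a x _ => by rw [matrixIn_self]; simp⟩

theorem Extension.Isomorphic.symm {P Q : Extension ι r E} (h : P.Isomorphic Q) :
    Q.Isomorphic P := by
  obtain ⟨W, H, K, hP, hQ, hH, hK, hHK, hc, hv⟩ := h
  refine ⟨W, K, H, hQ, hP, hK, hH, fun a x hx => (hHK a x hx).symm, fun a b x hx => ?_,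
    fun a x hx => ?_⟩
  · have h1 := (hHK a x hx.1).2
    have h2 := (hHK b x hx.2).1
    calc Q.trans a b x * K b x = K a x * H a x * (Q.trans a b x * K b x) := by rw [h1, one_mul]
      _ = K a x * (H a x * Q.trans a b x) * K b x := by simp only [mul_assoc]
      _ = K a x * P.trans a b x * (H b x * K b x) := by rw [← hc a b x hx]; simp only [mul_assoc]
      _ = K a x * P.trans a b x := by rw [h2, mul_one]
  · have h1 : (K a x).map (value ι x) * (H a x).map (value ι x) = 1 := by
      rw [← Matrix.map_mul, (hHK a x hx).2]
      simp
    calc (K a x).map (value ι x)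
        = (K a x).map (value ι x) *
          (matrixIn (P.frame a x) (Q.frame a x) (.id ℂ (E x)) *
            matrixIn (Q.frame a x) (P.frame a x) (.id ℂ (E x))) := by
          rw [matrixIn_mul, matrixIn_self, mul_one]
      _ = _ := by rw [← mul_assoc, ← hv a x hx, h1, one_mul]

theorem Extension.Isomorphic.trans {P Q R : Extension ι r E} (h : P.Isomorphic Q)
    (h' : Q.Isomorphic R) : P.Isomorphic R := by
  obtain ⟨W, H, K, hP, hQ, hH, hK, hHK, hc, hv⟩ := h
  obtain ⟨W', H', K', hP', hQ', hH', hK', hHK', hc', hv'⟩ := h'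
  refine ⟨W.inf W', fun a x => H a x * H' a x, fun a x => K' a x * K a x,
    fun a => inf_le_left.trans (hP a), fun a => inf_le_right.trans (hQ' a),
    fun a x hx => regular_mul (hH a x hx.1) (hH' a x hx.2),
    fun a x hx => regular_mul (hK' a x hx.2) (hK a x hx.1),
    fun a x hx => ⟨?_, ?_⟩, fun a b x hx => ?_, fun a x hx => ?_⟩
  · rw [mul_assoc, ← mul_assoc (H' a x), (hHK' a x hx.2).1, one_mul, (hHK a x hx.1).1]
  · rw [mul_assoc, ← mul_assoc (K a x), (hHK a x hx.1).2, one_mul, (hHK' a x hx.2).2]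
  · rw [← mul_assoc, hc a b x ⟨hx.1.1, hx.2.1⟩, mul_assoc, hc' a b x ⟨hx.1.2, hx.2.2⟩, mul_assoc]
  · rw [Matrix.map_mul, hv a x hx.1, hv' a x hx.2, matrixIn_mul]

instance extensionSetoid : Setoid (Extension ι r E) where
  r := Extension.Isomorphic
  iseqv := ⟨.refl, .symm, .trans⟩

variable (ι r E) in
/-- The set `C(E)` of isomorphism classes of extensions of `E` to `X₁`. -/
abbrev ExtensionClass : Type _ := Quotient (extensionSetoid (ι := ι) (r := r) (E := E))

end Extension

/-! ### The sheaves of forms with values in the endomorphisms of a vector bundle -/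

section Forms

variable {EX EY : Type*} [NormedAddCommGroup EX] [NormedSpace ℂ EX]
  [NormedAddCommGroup EY] [NormedSpace ℂ EY]
  {X Y : Type*} [TopologicalSpace X] [ChartedSpace EX X] [IsManifold 𝓘(ℂ, EX) ω X]
  [TopologicalSpace Y] [ChartedSpace EY Y] [IsManifold 𝓘(ℂ, EY) ω Y]
  (ι : C^ω⟮𝓘(ℂ, EX), X; 𝓘(ℂ, EY), Y⟯) (r : ℕ)
  (E : X → Type*) [∀ x, AddCommGroup (E x)] [∀ x, Module ℂ (E x)] [∀ x, TopologicalSpace (E x)]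
  [∀ x, IsTopologicalAddGroup (E x)] [∀ x, ContinuousSMul ℂ (E x)]
  [TopologicalSpace (TotalSpace (Fin r → ℂ) E)] [FiberBundle (Fin r → ℂ) E]
  [VectorBundle ℂ (Fin r → ℂ) E]

/-- The fibre at `x` of `Ω¹_{Y|X} ⊗ End E`: covectors of `Y` at `ι x` with values in the
endomorphisms of `E x`. -/
abbrev FormFiber (x : X) : Type _ := TangentSpace 𝓘(ℂ, EY) (ι x) →L[ℂ] (E x →L[ℂ] E x)

/-- A family of elements of the fibres of `Ω¹_{Y|X} ⊗ End E`, read as a function on `X` by means of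
the trivialization of `T Y` around `ι x` and of that of `End E` around `x`. -/
def inTrivializations (x : X) (s : ∀ z, FormFiber ι E z) (z : X) :
    EY →L[ℂ] ((Fin r → ℂ) →L[ℂ] (Fin r → ℂ)) :=
  ContinuousLinearMap.inCoordinates EY (TangentSpace 𝓘(ℂ, EY) : Y → Type _)
    ((Fin r → ℂ) →L[ℂ] (Fin r → ℂ)) (fun z => E z →L[ℂ] E z) (ι x) (ι z) x z (s z)

set_option synthInstance.maxHeartbeats 200000 in
/-- The sheaf `Ω¹_{Y|X} ⊗ End E` on `X` : the families which are holomorphic near `x`. -/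
def formSheaf (x : X) : AddSubgroup (∀ z, FormFiber ι E z) where
  carrier := {s | ContMDiffAt 𝓘(ℂ, EX) 𝓘(ℂ, EY →L[ℂ] ((Fin r → ℂ) →L[ℂ] (Fin r → ℂ))) ω
    (inTrivializations ι r E x s) x}
  zero_mem' := by
    have h : inTrivializations ι r E x 0 = 0 := by
      ext1 z
      simp [inTrivializations, ContinuousLinearMap.inCoordinates]
    change ContMDiffAt _ _ _ _ _
    rw [h]
    exact contMDiffAt_const
  add_mem' {s t} hs ht := by
    have h : inTrivializations ι r E x (s + t) =
        inTrivializations ι r E x s + inTrivializations ι r E x t := by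
      ext1 z
      simp [inTrivializations, ContinuousLinearMap.inCoordinates]
    change ContMDiffAt _ _ _ _ _
    rw [h]
    exact ContMDiffAt.add hs ht
  neg_mem' {s} hs := by
    have h : inTrivializations ι r E x (-s) = -inTrivializations ι r E x s := by
      ext1 z
      simp [inTrivializations, ContinuousLinearMap.inCoordinates]
    change ContMDiffAt _ _ _ _ _
    rw [h]
    exact ContMDiffAt.neg hs

/-- The sheaf `N*_{X/Y} ⊗ End E` on `X` : the sections of `Ω¹_{Y|X} ⊗ End E` whose pull-back to `X`
is zero, that is, which vanish on the vectors tangent to `X`. -/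
def conormalSheaf (x : X) : AddSubgroup (∀ z, FormFiber ι E z) where
  carrier := {s | s ∈ formSheaf ι r E x ∧
    ∀ᶠ z in 𝓝 x, ∀ v : TangentSpace 𝓘(ℂ, EX) z, s z (mfderiv 𝓘(ℂ, EX) 𝓘(ℂ, EY) ι z v) = 0}
  zero_mem' := ⟨zero_mem _, by simp⟩
  add_mem' := by
    rintro s t ⟨hs, hs'⟩ ⟨ht, ht'⟩
    refine ⟨add_mem hs ht, ?_⟩
    filter_upwards [hs', ht'] with z h k v
    rw [Pi.add_apply, add_apply, h, k, add_zero]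
  neg_mem' := by
    rintro s ⟨hs, hs'⟩
    refine ⟨neg_mem hs, ?_⟩
    filter_upwards [hs'] with z h v
    rw [Pi.neg_apply, neg_apply, h, neg_zero]

/-- The natural map `H¹(X, N*_{X/Y} ⊗ End E) → H¹(X, Ω¹_{Y|X} ⊗ End E)`. -/
def conormalToForms : H1 (conormalSheaf ι r E) →+ H1 (formSheaf ι r E) :=
  H1.map fun _ _ hs => hs.1

variable {ι r E}

/-- `a` is the Atiyah class in `H¹(X, Ω¹_{Y|X} ⊗ End E)` of the extension `P` : it is represented
by the cocycle `A_ij = g_λi Δ_iλ - g_λj Δ_jλ`, where an endomorphism of `E` is given by its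
matrices in the frames with index `λ` (here `l`). -/
def Extension.IsAtiyahClass (P : Extension ι r E) (a : H1 (formSheaf ι r E)) : Prop :=
  ∃ A : cocycles (formSheaf ι r E) P.cover, H1.mk A = a ∧
    ∀ i j l, ∀ x ∈ P.cover.nhd i ⊓ P.cover.nhd j ⊓ P.cover.nhd l, ∀ v,
      matrixIn (P.frame l x) (P.frame l x) (A.1 i j x v) =
        P.g l i x * P.Δ i l x v - P.g l j x * P.Δ j l x v

/-- `e' = e + γ` : there are representatives of `e` and `e'` with the same cover and frames (hence
the same `g_ij`) and a cocycle `C` on this cover representing `γ`, such that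
`Δ'_ij = Δ_ij + g_iλ C_ij g_λj`. -/
def IsTranslate (e : ExtensionClass ι r E) (γ : H1 (conormalSheaf ι r E))
    (e' : ExtensionClass ι r E) : Prop :=
  ∃ P Q : Extension ι r E, ⟦P⟧ = e ∧ ⟦Q⟧ = e' ∧ Q.cover = P.cover ∧ Q.frame = P.frame ∧
    ∃ C : cocycles (conormalSheaf ι r E) P.cover, H1.mk C = γ ∧
      ∀ i j l, ∀ x ∈ P.cover.nhd i ⊓ P.cover.nhd j ⊓ P.cover.nhd l, ∀ v,
        Q.Δ i j x v =
          P.Δ i j x v + P.g i l x * matrixIn (P.frame l x) (P.frame l x) (C.1 i j x v) * P.g l j x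

end Forms

end FirstOrderExtension

end

/-! ### Divided differences of analytic functions -/

section DividedDifference

variable {E F : Type*} [NormedAddCommGroup E] [NormedSpace ℂ E] [NormedAddCommGroup F]
  [NormedSpace ℂ F]

/-- The power series of the divided difference of a function with power series `p`: its term of
degree `m` sends `(u, v)` to `w ↦ ∑ k, p (m + 1) (u, …, u, w, v, …, v)`, with `w` in place `k`. -/
noncomputable def FormalMultilinearSeries.dividedDifference (p : FormalMultilinearSeries ℂ E F) :
    FormalMultilinearSeries ℂ (E × E) (E →L[ℂ] F) := fun m =>
  ∑ k : Fin (m + 1), (ContinuousLinearMap.flipMultilinear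
    ((p (m + 1)).curryMid k)).compContinuousLinearMap fun i : Fin m =>
      if i.castSucc < k then ContinuousLinearMap.fst ℂ E E else ContinuousLinearMap.snd ℂ E E

theorem FormalMultilinearSeries.dividedDifference_apply (p : FormalMultilinearSeries ℂ E F)
    (m : ℕ) (u v : E) :
    p.dividedDifference m (fun _ => (u, v)) (u - v) =
      p (m + 1) (fun _ => u) - p (m + 1) (fun _ => v) := by
  let a : ℕ → Fin (m + 1) → E := fun k i => if i.1 < k then u else v
  have key : ∀ k : Fin (m + 1), ((ContinuousLinearMap.flipMultilinear
      ((p (m + 1)).curryMid k)).compContinuousLinearMap fun i : Fin m =>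
        if i.castSucc < k then ContinuousLinearMap.fst ℂ E E else ContinuousLinearMap.snd ℂ E E)
        (fun _ => (u, v)) (u - v) = p (m + 1) (a (k + 1)) - p (m + 1) (a k) := by
    intro k
    have h1 : a (k + 1) = Function.update (a k) k u := by
      ext1 i
      by_cases h : i = k
      · subst h; simp [a]
      · have : i.1 ≠ k.1 := fun h' => h (Fin.ext h')
        simp only [a, Function.update_of_ne h]
        congr 1
        simp only [eq_iff_iff]
        omega
    have h2 : a k = Function.update (a k) k v := by
      ext1 i
      by_cases h : i = k
      · subst h; simp [a]
      · simp only [Function.update_of_ne h]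
    rw [h1]
    conv_rhs => arg 2; rw [h2]
    rw [← ContinuousMultilinearMap.map_update_sub]
    change p (m + 1) (k.insertNth (u - v) _) = _
    congr 1
    ext1 i
    rcases Fin.eq_self_or_eq_succAbove k i with rfl | ⟨j, rfl⟩
    · simp
    · rw [Fin.insertNth_apply_succAbove, Function.update_of_ne (Fin.succAbove_ne k j)]
      by_cases h : j.castSucc < k
      · rw [Fin.succAbove_of_castSucc_lt _ _ h]
        have h' : j.1 < k.1 := h
        simp [a, h, h']
      · rw [Fin.succAbove_of_le_castSucc _ _ (not_lt.1 h)]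
        have h' : ¬ j.1 + 1 < k.1 := by
          have : k.1 ≤ j.1 := not_lt.1 h
          omega
        simp [a, h, h']
  rw [FormalMultilinearSeries.dividedDifference, sum_apply, sum_apply]
  simp_rw [key]
  rw [Fin.sum_univ_eq_sum_range (fun k => p (m + 1) (a (k + 1)) - p (m + 1) (a k)),
    Finset.sum_range_sub (fun k => p (m + 1) (a k))]
  have h0 : a 0 = fun _ => v := by ext1 i; simp [a]
  have h1 : a (m + 1) = fun _ => u := by ext1 i; simp [a, i.is_lt]
  rw [h0, h1]

set_option synthInstance.maxHeartbeats 200000 in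
theorem FormalMultilinearSeries.norm_dividedDifference_le (p : FormalMultilinearSeries ℂ E F)
    (m : ℕ) : ‖p.dividedDifference m‖ ≤ (m + 1) * ‖p (m + 1)‖ := by
  rw [FormalMultilinearSeries.dividedDifference]
  refine (norm_sum_le (E := (E × E) [×m]→L[ℂ] (E →L[ℂ] F)) Finset.univ _).trans ?_
  suffices h : ∀ k : Fin (m + 1), ‖(ContinuousLinearMap.flipMultilinear
      ((p (m + 1)).curryMid k)).compContinuousLinearMap fun i : Fin m =>
        if i.castSucc < k then ContinuousLinearMap.fst ℂ E E
        else ContinuousLinearMap.snd ℂ E E‖ ≤ ‖p (m + 1)‖ from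
    (Finset.sum_le_card_nsmul _ _ _ fun k _ => h k).trans (by simp)
  intro k
  refine (ContinuousMultilinearMap.norm_compContinuousLinearMap_le _ _).trans ?_
  have h1 : ‖ContinuousLinearMap.flipMultilinear ((p (m + 1)).curryMid k)‖ ≤ ‖p (m + 1)‖ := by
    rw [← ContinuousMultilinearMap.norm_curryMid k (p (m + 1))]
    refine ContinuousMultilinearMap.opNorm_le_bound (by positivity) fun x => ?_
    refine ContinuousLinearMap.opNorm_le_bound _ (by positivity) fun w => ?_
    refine ((((p (m + 1)).curryMid k w).le_opNorm x)).trans ?_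
    calc ‖(p (m + 1)).curryMid k w‖ * ∏ i, ‖x i‖
        ≤ ‖(p (m + 1)).curryMid k‖ * ‖w‖ * ∏ i, ‖x i‖ := by
          gcongr
          exact ContinuousLinearMap.le_opNorm _ _
      _ = _ := by ring
  have h2 : ∏ i : Fin m, ‖(if i.castSucc < k then ContinuousLinearMap.fst ℂ E E
      else ContinuousLinearMap.snd ℂ E E)‖ ≤ 1 := by
    refine Finset.prod_le_one (fun _ _ => norm_nonneg _) fun i _ => ?_
    split_ifs
    · exact ContinuousLinearMap.norm_fst_le ..
    · exact ContinuousLinearMap.norm_snd_le ..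
  calc _ ≤ ‖p (m + 1)‖ * 1 := by gcongr
    _ = _ := mul_one _

set_option synthInstance.maxHeartbeats 200000 in
theorem FormalMultilinearSeries.dividedDifference_radius_pos (p : FormalMultilinearSeries ℂ E F)
    (hp : 0 < p.radius) : 0 < p.dividedDifference.radius := by
  obtain ⟨C, r, hC, hr, h⟩ := p.le_mul_pow_of_radius_pos hp
  have hr2 : 0 < (2 * r)⁻¹ := by positivity
  let ρ : NNReal := ⟨(2 * r)⁻¹, hr2.le⟩
  have hpos : (0 : ENNReal) < ρ := ENNReal.coe_pos.2 hr2
  refine hpos.trans_le ?_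
  refine FormalMultilinearSeries.le_radius_of_bound _ (C * r) fun m => ?_
  have h1 : ((m : ℝ) + 1) ≤ 2 ^ m := by exact_mod_cast Nat.lt_two_pow_self (n := m)
  calc ‖p.dividedDifference m‖ * ((2 * r)⁻¹) ^ m
      ≤ (2 ^ m * (C * r ^ (m + 1))) * ((2 * r)⁻¹) ^ m := by
        gcongr
        refine (p.norm_dividedDifference_le m).trans ?_
        gcongr
        exact h _
    _ = C * r := by
        rw [inv_pow, mul_pow, pow_succ]
        field_simp

set_option synthInstance.maxHeartbeats 200000 in
/-- An analytic function `f` has an analytic divided difference: `f u - f v = L (u, v) (u - v)`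
near a given point of the diagonal. -/
theorem AnalyticAt.exists_dividedDifference [CompleteSpace F] {f : E → F} {x : E}
    (hf : AnalyticAt ℂ f x) :
    ∃ L : E × E → E →L[ℂ] F, AnalyticAt ℂ L (x, x) ∧
      ∀ᶠ z in 𝓝 (x, x), f z.1 - f z.2 = L z (z.1 - z.2) := by
  obtain ⟨p, r, hp⟩ := hf
  have hq := p.dividedDifference.hasFPowerSeriesOnBall
    (p.dividedDifference_radius_pos (hp.r_pos.trans_le hp.r_le))
  have hq' := hq.comp_sub (x, x)
  rw [zero_add] at hq'
  refine ⟨_, hq'.analyticAt, ?_⟩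
  have e1 : ∀ᶠ z in 𝓝 (x, x), z.1 ∈ Metric.eball x r :=
    continuousAt_fst.eventually (Metric.eball_mem_nhds x hp.r_pos)
  have e2 : ∀ᶠ z in 𝓝 (x, x), z.2 ∈ Metric.eball x r :=
    continuousAt_snd.eventually (Metric.eball_mem_nhds x hp.r_pos)
  filter_upwards [e1, e2, Metric.eball_mem_nhds (x, x) hq'.r_pos] with z h1 h2 h3
  have s1 := (hp.hasSum_sub h1).sub (hp.hasSum_sub h2)
  have s2 := hq'.hasSum_sub h3
  have s3 := s2.mapL (ContinuousLinearMap.apply ℂ F (z.1 - z.2))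
  have e : ∀ m, ContinuousLinearMap.apply ℂ F (z.1 - z.2)
      (p.dividedDifference m fun _ => z - (x, x)) =
      p (m + 1) (fun _ => z.1 - x) - p (m + 1) (fun _ => z.2 - x) := fun m => by
    rw [← p.dividedDifference_apply, ContinuousLinearMap.apply_apply, sub_sub_sub_cancel_right]
    rfl
  simp_rw [e] at s3
  rw [← hasSum_nat_add_iff' 1] at s1
  have s4 := s1.unique s3
  rw [Finset.sum_range_one, Subsingleton.elim (fun _ : Fin 0 => z.1 - x) (fun _ => z.2 - x),
    sub_self, sub_zero] at s4
  exact s4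

theorem AnalyticAt.exists_dividedDifference_fderiv [CompleteSpace F] {f : E → F} {x : E}
    (hf : AnalyticAt ℂ f x) :
    ∃ L : E × E → E →L[ℂ] F, AnalyticAt ℂ L (x, x) ∧
      (∀ᶠ z in 𝓝 (x, x), f z.1 - f z.2 = L z (z.1 - z.2)) ∧
      ∀ᶠ u in 𝓝 x, L (u, u) = fderiv ℂ f u := by
  obtain ⟨L, hL, h⟩ := hf.exists_dividedDifference
  refine ⟨L, hL, h, ?_⟩
  have hdiag : Filter.Tendsto (fun u : E => (u, u)) (𝓝 x) (𝓝 (x, x)) :=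
    (continuous_id.prodMk continuous_id).tendsto x
  filter_upwards [hdiag.eventually h.eventually_nhds, hdiag.eventually hL.eventually_analyticAt]
    with u h1 h2
  have hm : HasFDerivAt (fun v : E => (v, u)) (ContinuousLinearMap.inl ℂ E E) u := by
    exact (hasFDerivAt_id u).prodMk (hasFDerivAt_const u u)
  have h3 := (h2.differentiableAt.hasFDerivAt.comp (g := L) (f := fun v : E => (v, u)) u hm
    ).clm_apply
    ((hasFDerivAt_id u).sub (hasFDerivAt_const u u))
  have h4 : f =ᶠ[𝓝 u] fun v => f u + L (v, u) (v - u) := by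
    have := ((Continuous.prodMk continuous_id continuous_const).tendsto u).eventually h1
    filter_upwards [this] with v hv
    simp only [id] at hv
    rw [← hv]
    abel
  have h5 := (h3.const_add (f u)).congr_of_eventuallyEq h4
  rw [h5.fderiv]
  ext v
  simp

end DividedDifference

/-! ### Local retractions onto an immersed submanifold -/

section Retraction

variable {EX EY : Type*} [NormedAddCommGroup EX] [NormedSpace ℂ EX]
  [NormedAddCommGroup EY] [NormedSpace ℂ EY]
  {X Y : Type*} [TopologicalSpace X] [ChartedSpace EX X]
  [TopologicalSpace Y] [ChartedSpace EY Y]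

/-- An immersion has a left inverse locally on the source and on the target. -/
theorem Manifold.IsImmersionAt.exists_leftInverse {f : X → Y} {x : X}
    (h : Manifold.IsImmersionAt 𝓘(ℂ, EX) 𝓘(ℂ, EY) ω f x) :
    ∃ ρ : Y → X, ContMDiffAt 𝓘(ℂ, EY) 𝓘(ℂ, EX) ω ρ (f x) ∧ ∀ᶠ z in 𝓝 x, ρ (f z) = z := by
  let φ := h.domChart
  let ψ := h.codChart
  let pr : EY →L[ℂ] EX := (ContinuousLinearMap.fst ℂ EX h.complement).comp
    (h.equiv.symm : EY →L[ℂ] EX × h.complement)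
  have hw : ∀ z ∈ φ.source, ψ (f z) = h.equiv (φ z, 0) := fun z hz => by
    have hz' : φ z ∈ (h.domChart.extend 𝓘(ℂ, EX)).target := by
      simpa using φ.map_source hz
    have := h.writtenInCharts hz'
    simpa [φ, ψ, φ.left_inv hz, h.domChart.left_inv hz] using this
  have hpr : ∀ z ∈ φ.source, pr (ψ (f z)) = φ z := fun z hz => by
    rw [hw z hz]
    simp [pr]
  refine ⟨fun y => φ.symm (pr (ψ y)), ?_, ?_⟩
  · have h1 : ContMDiffAt 𝓘(ℂ, EY) 𝓘(ℂ, EY) ω ψ (f x) :=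
      contMDiffAt_of_mem_maximalAtlas h.codChart_mem_maximalAtlas h.mem_codChart_source
    have h2 : ContMDiffAt 𝓘(ℂ, EY) 𝓘(ℂ, EX) ω (fun y => pr (ψ y)) (f x) :=
      (pr.contMDiff (n := ω)).contMDiffAt.comp _ h1
    have h3 : ContMDiffAt 𝓘(ℂ, EX) 𝓘(ℂ, EX) ω φ.symm (pr (ψ (f x))) := by
      refine contMDiffAt_symm_of_mem_maximalAtlas h.domChart_mem_maximalAtlas ?_
      rw [hpr x h.mem_domChart_source]
      exact φ.map_source h.mem_domChart_source
    exact ContMDiffAt.comp (f x) (g := φ.symm) (f := fun y => pr (ψ y)) h3 h2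
  · filter_upwards [φ.open_source.mem_nhds h.mem_domChart_source] with z hz
    rw [hpr z hz, φ.left_inv hz]

end Retraction

/-! ### Divided differences on a complex manifold -/

section ManifoldDividedDifference

variable {E V : Type*} [NormedAddCommGroup E] [NormedSpace ℂ E]
  [NormedAddCommGroup V] [NormedSpace ℂ V]
  {M : Type*} [TopologicalSpace M] [ChartedSpace E M]

theorem ContMDiffAt.analyticAt_comp_extChartAt_symm {F : M → V} {y : M}
    (hF : ContMDiffAt 𝓘(ℂ, E) 𝓘(ℂ, V) ω F y) :
    AnalyticAt ℂ (F ∘ (extChartAt 𝓘(ℂ, E) y).symm) (extChartAt 𝓘(ℂ, E) y y) := by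
  have h := contMDiffAt_iff_source.1 hF
  rw [ModelWithCorners.range_eq_univ, contMDiffWithinAt_univ, contMDiffAt_iff_contDiffAt] at h
  exact h.analyticAt

theorem ContMDiffAt.eventually_mdifferentiableAt [IsManifold 𝓘(ℂ, E) ω M] {F : M → V} {y : M}
    (hF : ContMDiffAt 𝓘(ℂ, E) 𝓘(ℂ, V) ω F y) :
    ∀ᶠ z in 𝓝 y, MDifferentiableAt 𝓘(ℂ, E) 𝓘(ℂ, V) F z :=
  ((contMDiffAt_iff_contMDiffAt_nhds (by simp)).1 hF).mono fun _ h =>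
    h.mdifferentiableAt (by simp)

/-- The divided difference of a holomorphic function in a chart. -/
theorem ContMDiffAt.exists_dividedDifference [CompleteSpace V] [IsManifold 𝓘(ℂ, E) ω M]
    {F : M → V} {y : M}
    (hF : ContMDiffAt 𝓘(ℂ, E) 𝓘(ℂ, V) ω F y) :
    ∃ L : E × E → E →L[ℂ] V,
      AnalyticAt ℂ L (extChartAt 𝓘(ℂ, E) y y, extChartAt 𝓘(ℂ, E) y y) ∧
      (∀ᶠ p in 𝓝 (y, y), F p.1 - F p.2 =
        L (extChartAt 𝓘(ℂ, E) y p.1, extChartAt 𝓘(ℂ, E) y p.2)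
          (extChartAt 𝓘(ℂ, E) y p.1 - extChartAt 𝓘(ℂ, E) y p.2)) ∧
      ∀ᶠ z in 𝓝 y, mfderiv 𝓘(ℂ, E) 𝓘(ℂ, V) F z = 0 →
        L (extChartAt 𝓘(ℂ, E) y z, extChartAt 𝓘(ℂ, E) y z) = 0 := by
  obtain ⟨L, hL, h1, h2⟩ := hF.analyticAt_comp_extChartAt_symm.exists_dividedDifference_fderiv
  have hc : ContinuousAt (extChartAt 𝓘(ℂ, E) y) y := continuousAt_extChartAt y
  have hs : ∀ᶠ z in 𝓝 y, z ∈ (extChartAt 𝓘(ℂ, E) y).source := extChartAt_source_mem_nhds y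
  refine ⟨L, hL, ?_, ?_⟩
  · have hcc : ContinuousAt (fun p : M × M => (extChartAt 𝓘(ℂ, E) y p.1,
        extChartAt 𝓘(ℂ, E) y p.2)) (y, y) :=
      (hc.comp (x := (y, y)) continuousAt_fst).prodMk (hc.comp (x := (y, y)) continuousAt_snd)
    filter_upwards [hcc.eventually h1, (continuousAt_fst (p := (y, y))).eventually hs,
      (continuousAt_snd (p := (y, y))).eventually hs] with p hp hp1 hp2
    rw [← hp, Function.comp_apply, Function.comp_apply,
      (extChartAt 𝓘(ℂ, E) y).left_inv hp1, (extChartAt 𝓘(ℂ, E) y).left_inv hp2]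
  · filter_upwards [hc.eventually h2, hs, hF.eventually_mdifferentiableAt] with z hz hzs hd h0
    rw [hz, ← mfderiv_eq_fderiv]
    have hd' : MDifferentiableAt 𝓘(ℂ, E) 𝓘(ℂ, V) F
        ((extChartAt 𝓘(ℂ, E) y).symm (extChartAt 𝓘(ℂ, E) y z)) := by
      rwa [(extChartAt 𝓘(ℂ, E) y).left_inv hzs]
    have hd'' : MDifferentiableAt 𝓘(ℂ, E) 𝓘(ℂ, E) (extChartAt 𝓘(ℂ, E) y).symm
        (extChartAt 𝓘(ℂ, E) y z) := by
      have := mdifferentiableWithinAt_extChartAt_symm (I := 𝓘(ℂ, E))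
        ((extChartAt 𝓘(ℂ, E) y).map_source hzs)
      rwa [ModelWithCorners.range_eq_univ, mdifferentiableWithinAt_univ] at this
    rw [mfderiv_comp _ hd' hd'', (extChartAt 𝓘(ℂ, E) y).left_inv hzs, h0]
    exact ContinuousLinearMap.zero_comp _

end ManifoldDividedDifference

namespace FirstOrderExtension

section Thickening

variable {EX EY : Type*} [NormedAddCommGroup EX] [NormedSpace ℂ EX]
  [NormedAddCommGroup EY] [NormedSpace ℂ EY]
  {X Y : Type*} [TopologicalSpace X] [ChartedSpace EX X] [TopologicalSpace Y] [ChartedSpace EY Y]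

/-- A holomorphic function near `ι x` which vanishes to the second order along `X` is a quadratic
expression in the functions `κ y - κ (ι (ρ y))`, where `κ` is a chart and `ρ` a retraction. -/
theorem exists_quadratic [IsManifold 𝓘(ℂ, EY) ω Y] {V : Type*} [NormedAddCommGroup V]
    [NormedSpace ℂ V] [CompleteSpace V] (ι : C^ω⟮𝓘(ℂ, EX), X; 𝓘(ℂ, EY), Y⟯) {x : X}
    {ρ : Y → X} (hρ : ContMDiffAt 𝓘(ℂ, EY) 𝓘(ℂ, EX) ω ρ (ι x)) (hρι : ∀ᶠ z in 𝓝 x, ρ (ι z) = z)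
    {F : Y → V} (hF : ContMDiffAt 𝓘(ℂ, EY) 𝓘(ℂ, V) ω F (ι x))
    (h0 : ∀ᶠ z in 𝓝 x, F (ι z) = 0)
    (h1 : ∀ᶠ z in 𝓝 x, mfderiv 𝓘(ℂ, EY) 𝓘(ℂ, V) F (ι z) = 0) :
    ∃ N : Y → EY →L[ℂ] EY →L[ℂ] V,
      ContMDiffAt 𝓘(ℂ, EY) 𝓘(ℂ, EY →L[ℂ] EY →L[ℂ] V) ω N (ι x) ∧
      ∀ᶠ y in 𝓝 (ι x), F y =
        N y (extChartAt 𝓘(ℂ, EY) (ι x) y - extChartAt 𝓘(ℂ, EY) (ι x) (ι (ρ y)))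
          (extChartAt 𝓘(ℂ, EY) (ι x) y - extChartAt 𝓘(ℂ, EY) (ι x) (ι (ρ y))) := by
  have hx : ρ (ι x) = x := hρι.self_of_nhds
  have hρc : Filter.Tendsto ρ (𝓝 (ι x)) (𝓝 x) := by
    have := hρ.continuousAt
    rwa [ContinuousAt, hx] at this
  have hιρ : ContMDiffAt 𝓘(ℂ, EY) 𝓘(ℂ, EY) ω (fun y => ι (ρ y)) (ι x) :=
    (ι.contMDiff.contMDiffAt (x := ρ (ι x))).comp (ι x) hρ
  have hιρx : ι (ρ (ι x)) = ι x := by rw [hx]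
  have hκ : ContMDiffAt 𝓘(ℂ, EY) 𝓘(ℂ, EY) ω (extChartAt 𝓘(ℂ, EY) (ι x)) (ι x) :=
    contMDiffAt_extChartAt
  have hκρ : ContMDiffAt 𝓘(ℂ, EY) 𝓘(ℂ, EY) ω
      (fun y => extChartAt 𝓘(ℂ, EY) (ι x) (ι (ρ y))) (ι x) :=
    ContMDiffAt.comp (ι x) (g := extChartAt 𝓘(ℂ, EY) (ι x)) (f := fun y => ι (ρ y))
      (by rw [hιρx]; exact hκ) hιρ
  have hpair : ContMDiffAt 𝓘(ℂ, EY) 𝓘(ℂ, EY × EY) ω (fun y =>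
      (extChartAt 𝓘(ℂ, EY) (ι x) y, extChartAt 𝓘(ℂ, EY) (ι x) (ι (ρ y)))) (ι x) :=
    hκ.prodMk_space hκρ
  have hpc : Filter.Tendsto (fun y => (y, ι (ρ y))) (𝓝 (ι x)) (𝓝 (ι x, ι x)) := by
    have := (continuousAt_id (x := ι x)).prodMk hιρ.continuousAt
    rw [ContinuousAt, hιρx] at this
    exact this
  have hιc : Filter.Tendsto ι (𝓝 x) (𝓝 (ι x)) := ι.contMDiff.continuous.continuousAt
  obtain ⟨L, hL, hL1, hL2⟩ := hF.exists_dividedDifference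
  let K : Y → EY →L[ℂ] V := fun y =>
    L (extChartAt 𝓘(ℂ, EY) (ι x) y, extChartAt 𝓘(ℂ, EY) (ι x) (ι (ρ y)))
  have hK : ContMDiffAt 𝓘(ℂ, EY) 𝓘(ℂ, EY →L[ℂ] V) ω K (ι x) := by
    refine ContDiffAt.comp_contMDiffAt (g := L) (x := ι x) ?_ hpair
    rw [hιρx]
    exact hL.contDiffAt
  have hK0 : ∀ᶠ y in 𝓝 (ι x), K (ι (ρ y)) = 0 := by
    filter_upwards [hρc.eventually h1, (hιc.comp hρc).eventually hL2, hρc.eventually hρι]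
      with y hy hy' hy''
    simp only [K, hy'']
    exact hy' hy
  obtain ⟨M, hM, hM1, -⟩ := hK.exists_dividedDifference
  refine ⟨fun y => M (extChartAt 𝓘(ℂ, EY) (ι x) y, extChartAt 𝓘(ℂ, EY) (ι x) (ι (ρ y))), ?_, ?_⟩
  · refine ContDiffAt.comp_contMDiffAt (g := M) (x := ι x) ?_ hpair
    rw [hιρx]
    exact hM.contDiffAt
  · filter_upwards [hpc.eventually hL1, hpc.eventually hM1, hK0, hρc.eventually h0]
      with y e1 e2 e3 e4
    rw [e4, sub_zero] at e1
    rw [e3, sub_zero] at e2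
    rw [← e2, e1]

end Thickening

section Thickening

variable {EX EY : Type*} [NormedAddCommGroup EX] [NormedSpace ℂ EX]
  [NormedAddCommGroup EY] [NormedSpace ℂ EY]
  {X Y : Type*} [TopologicalSpace X] [ChartedSpace EX X] [TopologicalSpace Y] [ChartedSpace EY Y]
  (ι : C^ω⟮𝓘(ℂ, EX), X; 𝓘(ℂ, EY), Y⟯)

/-! ### The Leibniz rule -/

theorem differential_add {x : X} (s t : Stalk ι x) :
    differential ι x (s + t) = differential ι x s + differential ι x t := by
  obtain ⟨F, rfl⟩ := Ideal.Quotient.mk_surjective s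
  obtain ⟨G, rfl⟩ := Ideal.Quotient.mk_surjective t
  exact ((mdifferentiableAt_of_mem F).hasMFDerivAt.add
    (mdifferentiableAt_of_mem G).hasMFDerivAt).mfderiv

theorem differential_mul {x : X} (s t : Stalk ι x) :
    differential ι x (s * t) = value ι x s • differential ι x t +
      value ι x t • differential ι x s := by
  obtain ⟨F, rfl⟩ := Ideal.Quotient.mk_surjective s
  obtain ⟨G, rfl⟩ := Ideal.Quotient.mk_surjective t
  exact ((mdifferentiableAt_of_mem F).hasMFDerivAt.mul
    (mdifferentiableAt_of_mem G).hasMFDerivAt).mfderiv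

/-- The evaluation of the differential at a tangent vector. -/
noncomputable def differentialApply {x : X} (v : TangentSpace 𝓘(ℂ, EY) (ι x)) : Stalk ι x →+ ℂ :=
  AddMonoidHom.mk' (fun s => differential ι x s v) fun s t => by
    rw [differential_add]
    rfl

theorem differentialApply_mul {x : X} (v : TangentSpace 𝓘(ℂ, EY) (ι x)) (s t : Stalk ι x) :
    differentialApply ι v (s * t) = value ι x s * differentialApply ι v t +
      differentialApply ι v s * value ι x t := by
  change differential ι x (s * t) v = _
  rw [differential_mul, mul_comm (differentialApply ι v s)]
  rfl

/-! ### Regular families -/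

open Classical in
/-- The family of elements of the stalks induced by a function on `Y`. -/
noncomputable def germ (F : Y → ℂ) (z : X) : Stalk ι z :=
  if h : F ∈ holomorphicAt EY (ι z) then Ideal.Quotient.mk _ ⟨F, h⟩ else 0

theorem germ_of_mem {F : Y → ℂ} {z : X} (h : F ∈ holomorphicAt EY (ι z)) :
    germ ι F z = Ideal.Quotient.mk _ ⟨F, h⟩ := dif_pos h

theorem value_germ {F : Y → ℂ} {z : X} (h : F ∈ holomorphicAt EY (ι z)) :
    value ι z (germ ι F z) = F (ι z) := by
  rw [germ_of_mem ι h]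
  rfl

theorem differential_germ {F : Y → ℂ} {z : X} (h : F ∈ holomorphicAt EY (ι z)) :
    differential ι z (germ ι F z) = mfderiv 𝓘(ℂ, EY) 𝓘(ℂ) F (ι z) := by
  rw [germ_of_mem ι h]
  rfl

variable [IsManifold 𝓘(ℂ, EY) ω Y]

theorem eventually_mem_holomorphicAt {F : Y → ℂ} {x : X} (h : F ∈ holomorphicAt EY (ι x)) :
    ∀ᶠ z in 𝓝 x, F ∈ holomorphicAt EY (ι z) :=
  ι.contMDiff.continuous.continuousAt.eventually
    ((contMDiffAt_iff_contMDiffAt_nhds (by simp)).1 h)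

theorem germ_mem_regularAt {F : Y → ℂ} {x : X} (h : F ∈ holomorphicAt EY (ι x)) :
    germ ι F ∈ regularAt ι x :=
  ⟨F, (eventually_mem_holomorphicAt ι h).mono fun _ hz => ⟨hz, germ_of_mem ι hz⟩⟩

omit [IsManifold 𝓘(ℂ, EY) ω Y] in
theorem exists_eq_germ {s : ∀ z, Stalk ι z} {x : X} (h : s ∈ regularAt ι x) :
    ∃ F : Y → ℂ, ∀ᶠ z in 𝓝 x, F ∈ holomorphicAt EY (ι z) ∧ s z = germ ι F z := by
  obtain ⟨F, hF⟩ := h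
  exact ⟨F, hF.mono fun z ⟨h, e⟩ => ⟨h, by rw [e, germ_of_mem ι h]⟩⟩

omit [IsManifold 𝓘(ℂ, EY) ω Y] in
theorem regularAt_congr {s t : ∀ z, Stalk ι z} {x : X} (h : s ∈ regularAt ι x)
    (hst : ∀ᶠ z in 𝓝 x, s z = t z) : t ∈ regularAt ι x := by
  obtain ⟨F, hF⟩ := h
  refine ⟨F, ?_⟩
  filter_upwards [hF, hst] with z ⟨hz, e⟩ e'
  exact ⟨hz, e' ▸ e⟩

omit [IsManifold 𝓘(ℂ, EY) ω Y] in
/-- A function which vanishes near `ι x` lies in the square of the ideal: it is its own product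
with the indicator function of a set. -/
theorem mem_idealAt_sq_of_eventually_eq_zero {x : X} (F : holomorphicAt EY (ι x))
    (h : ∀ᶠ y in 𝓝 (ι x), F.1 y = 0) : F ∈ (idealAt ι x) ^ 2 := by
  classical
  let χ : Y → ℂ := fun y => if F.1 y = 0 then 0 else 1
  have hχ0 : χ =ᶠ[𝓝 (ι x)] fun _ => 0 := h.mono fun y hy => if_pos hy
  have hχ : χ ∈ holomorphicAt EY (ι x) :=
    (contMDiffAt_const (c := (0 : ℂ))).congr_of_eventuallyEq hχ0
  have hc : Filter.Tendsto ι (𝓝 x) (𝓝 (ι x)) := ι.contMDiff.continuous.continuousAt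
  have e : F = F * ⟨χ, hχ⟩ := by
    ext y
    change F.1 y = F.1 y * χ y
    by_cases hy : F.1 y = 0 <;> simp [χ, hy]
  rw [e, pow_two]
  exact Ideal.mul_mem_mul (hc.eventually h) (hc.eventually hχ0)

omit [IsManifold 𝓘(ℂ, EY) ω Y] in
theorem germ_eq_of_eventuallyEq {x : X} {F G : Y → ℂ} (hF : F ∈ holomorphicAt EY (ι x))
    (hG : G ∈ holomorphicAt EY (ι x)) (h : F =ᶠ[𝓝 (ι x)] G) : germ ι F x = germ ι G x := by
  rw [germ_of_mem ι hF, germ_of_mem ι hG, Ideal.Quotient.eq]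
  exact mem_idealAt_sq_of_eventually_eq_zero ι _ (h.mono fun y hy => sub_eq_zero.2 hy)

omit [IsManifold 𝓘(ℂ, EY) ω Y] in
theorem germ_mul_germ_inv {x : X} {F : Y → ℂ} (hF : F ∈ holomorphicAt EY (ι x))
    (h : F (ι x) ≠ 0) : germ ι F x * germ ι F⁻¹ x = 1 := by
  have hG : F⁻¹ ∈ holomorphicAt EY (ι x) := ContMDiffAt.inv₀ hF h
  have e : germ ι F x * germ ι F⁻¹ x = germ ι (F * F⁻¹) x := by
    rw [germ_of_mem ι hF, germ_of_mem ι hG, germ_of_mem ι (mul_mem hF hG), ← map_mul]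
    rfl
  have e1 : germ ι 1 x = 1 := germ_of_mem ι (one_mem _)
  rw [e, ← e1]
  refine germ_eq_of_eventuallyEq ι (mul_mem hF hG) (one_mem _) ?_
  have hc : ContinuousAt F (ι x) := ContMDiffAt.continuousAt hF
  filter_upwards [hc.eventually_ne h] with y hy
  simp [hy]

omit [IsManifold 𝓘(ℂ, EY) ω Y] in
theorem isUnit_of_value_ne_zero {x : X} {s : Stalk ι x} (h : value ι x s ≠ 0) : IsUnit s := by
  obtain ⟨F, rfl⟩ := Ideal.Quotient.mk_surjective s
  have e := germ_mul_germ_inv ι F.2 h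
  rw [germ_of_mem ι F.2] at e
  exact IsUnit.of_mul_eq_one _ e

theorem inverse_mem_regularAt {s : ∀ z, Stalk ι z} {x : X} (hs : s ∈ regularAt ι x)
    (h : value ι x (s x) ≠ 0) : (fun z => Ring.inverse (s z)) ∈ regularAt ι x := by
  obtain ⟨F, hF⟩ := exists_eq_germ ι hs
  have hFx := hF.self_of_nhds
  rw [hFx.2, value_germ ι hFx.1] at h
  have hc : ContinuousAt F (ι x) := ContMDiffAt.continuousAt hFx.1
  have hne := ι.contMDiff.continuous.continuousAt.eventually (hc.eventually_ne h)
  refine regularAt_congr ι (germ_mem_regularAt ι (ContMDiffAt.inv₀ hFx.1 h)) ?_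
  filter_upwards [hF, hne] with z ⟨hz, e⟩ hz'
  rw [e]
  have e1 := germ_mul_germ_inv ι hz hz'
  have e2 := Ring.inverse_mul_cancel_left (germ ι F z) (germ ι F⁻¹ z) (.of_mul_eq_one _ e1)
  rw [e1, mul_one] at e2
  exact e2.symm

/-! ### Regular families are determined by their values and differentials -/

section Immersion

variable {ι} [FiniteDimensional ℂ EY]
  (hι : Manifold.IsImmersion 𝓘(ℂ, EX) 𝓘(ℂ, EY) ω ι)

include hι

theorem germ_eq_zero {x : X} {F : Y → ℂ} (hF : F ∈ holomorphicAt EY (ι x))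
    (h0 : ∀ᶠ z in 𝓝 x, F (ι z) = 0)
    (h1 : ∀ᶠ z in 𝓝 x, mfderiv 𝓘(ℂ, EY) 𝓘(ℂ) F (ι z) = 0) : germ ι F x = 0 := by
  obtain ⟨ρ, hρ, hρι⟩ := (hι.isImmersionAt x).exists_leftInverse
  obtain ⟨N, hN, h⟩ := exists_quadratic ι hρ hρι hF h0 h1
  have hx : ρ (ι x) = x := hρι.self_of_nhds
  have hκ : ContMDiffAt 𝓘(ℂ, EY) 𝓘(ℂ, EY) ω (extChartAt 𝓘(ℂ, EY) (ι x)) (ι x) :=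
    contMDiffAt_extChartAt
  have hιρ : ContMDiffAt 𝓘(ℂ, EY) 𝓘(ℂ, EY) ω (fun y => ι (ρ y)) (ι x) :=
    (ι.contMDiff.contMDiffAt (x := ρ (ι x))).comp (ι x) hρ
  have hκρ : ContMDiffAt 𝓘(ℂ, EY) 𝓘(ℂ, EY) ω
      (fun y => extChartAt 𝓘(ℂ, EY) (ι x) (ι (ρ y))) (ι x) :=
    ContMDiffAt.comp (ι x) (g := extChartAt 𝓘(ℂ, EY) (ι x)) (f := fun y => ι (ρ y))
      (by rw [hx]; exact hκ) hιρ
  let b := Module.finBasis ℂ EY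
  let c : Fin _ → EY →L[ℂ] ℂ := fun i => (b.coord i).toContinuousLinearMap
  let δ : Y → EY := fun y =>
    extChartAt 𝓘(ℂ, EY) (ι x) y - extChartAt 𝓘(ℂ, EY) (ι x) (ι (ρ y))
  have hδ : ContMDiffAt 𝓘(ℂ, EY) 𝓘(ℂ, EY) ω δ (ι x) := hκ.sub hκρ
  have hδc : ∀ i, (fun y => c i (δ y)) ∈ holomorphicAt EY (ι x) := fun i =>
    ((c i).contMDiff (n := ω)).contMDiffAt.comp _ hδ
  have hδI : ∀ i, (⟨_, hδc i⟩ : holomorphicAt EY (ι x)) ∈ idealAt ι x := fun i =>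
    hρι.mono fun z hz => by simp [δ, hz]
  have hNc : ∀ i j, (fun y => N y (b i) (b j)) ∈ holomorphicAt EY (ι x) := fun i j =>
    (hN.clm_apply contMDiffAt_const).clm_apply contMDiffAt_const
  let G : holomorphicAt EY (ι x) := ∑ i, ∑ j, (⟨_, hδc i⟩ * ⟨_, hδc j⟩) * ⟨_, hNc i j⟩
  have hG : G ∈ (idealAt ι x) ^ 2 := by
    rw [pow_two]
    exact sum_mem fun i _ => sum_mem fun j _ =>
      Ideal.mul_mem_right _ _ (Ideal.mul_mem_mul (hδI i) (hδI j))
  have hGF : ∀ᶠ y in 𝓝 (ι x), F y = G.1 y := by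
    filter_upwards [h] with y hy
    have e : δ y = ∑ i, c i (δ y) • b i := (b.sum_repr (δ y)).symm
    have e' : G.1 y = ∑ i, ∑ j, c i (δ y) * c j (δ y) * N y (b i) (b j) := by
      simp only [G, AddSubmonoidClass.coe_finsetSum, Finset.sum_apply]
      rfl
    rw [hy, e']
    change N y (δ y) (δ y) = _
    conv_lhs => rw [e]
    simp only [map_sum, map_smul, sum_apply, smul_apply, smul_eq_mul, Finset.mul_sum]
    rw [Finset.sum_comm]
    exact Finset.sum_congr rfl fun i _ => Finset.sum_congr rfl fun j _ => by ring
  rw [germ_eq_of_eventuallyEq ι hF G.2 hGF, germ_of_mem ι G.2]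
  exact Ideal.Quotient.eq_zero_iff_mem.2 hG

theorem eq_zero_of_value_of_differential {x : X} {s : ∀ z, Stalk ι z} (hs : s ∈ regularAt ι x)
    (h0 : ∀ᶠ z in 𝓝 x, value ι z (s z) = 0)
    (h1 : ∀ᶠ z in 𝓝 x, differential ι z (s z) = 0) : s x = 0 := by
  obtain ⟨F, hF⟩ := exists_eq_germ ι hs
  rw [hF.self_of_nhds.2]
  refine germ_eq_zero hι hF.self_of_nhds.1 ?_ ?_
  · filter_upwards [hF, h0] with z ⟨hz, e⟩ h
    rwa [e, value_germ ι hz] at h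
  · filter_upwards [hF, h1] with z ⟨hz, e⟩ h
    rwa [e, differential_germ ι hz] at h

end Immersion

end Thickening

section Covectors

variable {EX EY : Type*} [NormedAddCommGroup EX] [NormedSpace ℂ EX]
  [NormedAddCommGroup EY] [NormedSpace ℂ EY]
  {X Y : Type*} [TopologicalSpace X] [ChartedSpace EX X] [TopologicalSpace Y] [ChartedSpace EY Y]
  (ι : C^ω⟮𝓘(ℂ, EX), X; 𝓘(ℂ, EY), Y⟯)

/-! ### Holomorphic families of covectors -/

theorem differential_mfderiv_eq_zero {s : ∀ z, Stalk ι z} {x : X} (hs : s ∈ regularAt ι x)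
    (h0 : ∀ᶠ z in 𝓝 x, value ι z (s z) = 0) (v : TangentSpace 𝓘(ℂ, EX) x) :
    differential ι x (s x) (mfderiv 𝓘(ℂ, EX) 𝓘(ℂ, EY) ι x v) = 0 := by
  obtain ⟨F, hF⟩ := exists_eq_germ ι hs
  have hFx := hF.self_of_nhds
  have h : (F ∘ ι) =ᶠ[𝓝 x] fun _ => 0 := by
    filter_upwards [hF, h0] with z ⟨hz, e⟩ h
    rwa [e, value_germ ι hz] at h
  have h' := h.mfderiv_eq (I := 𝓘(ℂ, EX)) (I' := 𝓘(ℂ))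
  rw [mfderiv_comp x (ContMDiffAt.mdifferentiableAt hFx.1 (by simp))
    (ι.contMDiff.contMDiffAt.mdifferentiableAt (by simp)), mfderiv_const] at h'
  rw [hFx.2, differential_germ ι hFx.1]
  exact DFunLike.congr_fun h' v

theorem eventually_mem_chartAt_source (x : X) :
    ∀ᶠ z in 𝓝 x, ι z ∈ (chartAt EY (ι x)).source :=
  ι.contMDiff.continuous.continuousAt.eventually (chart_source_mem_nhds EY (ι x))

variable [IsManifold 𝓘(ℂ, EY) ω Y]

/-- A family of covectors of `Y` at the points of `X`, read as a function on `X` by means of the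
trivialization of `T Y` around `ι x`. -/
noncomputable def covectorInTrivialization (x : X)
    (θ : ∀ z, TangentSpace 𝓘(ℂ, EY) (ι z) →L[ℂ] ℂ) (z : X) : EY →L[ℂ] ℂ :=
  (θ z).comp ((trivializationAt EY (TangentSpace 𝓘(ℂ, EY) : Y → Type _) (ι x)).symmL ℂ (ι z))

/-- The family of covectors is holomorphic near `x`. -/
def IsHolomorphicCovector (x : X) (θ : ∀ z, TangentSpace 𝓘(ℂ, EY) (ι z) →L[ℂ] ℂ) : Prop :=
  ContMDiffAt 𝓘(ℂ, EX) 𝓘(ℂ, EY →L[ℂ] ℂ) ω (covectorInTrivialization ι x θ) x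

theorem covectorInTrivialization_apply {x z : X} (hz : ι z ∈ (chartAt EY (ι x)).source)
    (θ : ∀ z, TangentSpace 𝓘(ℂ, EY) (ι z) →L[ℂ] ℂ) (v : TangentSpace 𝓘(ℂ, EY) (ι z)) :
    covectorInTrivialization ι x θ z
      (mfderiv 𝓘(ℂ, EY) 𝓘(ℂ, EY) (extChartAt 𝓘(ℂ, EY) (ι x)) (ι z) v) = θ z v := by
  rw [← TangentBundle.continuousLinearMapAt_trivializationAt hz]
  exact congrArg (θ z) (Trivialization.symmL_continuousLinearMapAt _ hz v)

variable [IsManifold 𝓘(ℂ, EX) ω X]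

theorem isHolomorphicCovector_differential {s : ∀ z, Stalk ι z} {x : X} (hs : s ∈ regularAt ι x) :
    IsHolomorphicCovector ι x fun z => differential ι z (s z) := by
  obtain ⟨F, hF⟩ := exists_eq_germ ι hs
  have h := ContMDiffAt.mfderiv (n := ω) (m := ω) (I := 𝓘(ℂ, EY)) (I' := 𝓘(ℂ)) (fun _ : X => F) ι
    (x₀ := x) (ContMDiffAt.comp (x, ι x) (g := F) (f := Prod.snd) hF.self_of_nhds.1
      contMDiffAt_snd) ι.contMDiff.contMDiffAt le_rfl
  refine h.congr_of_eventuallyEq ?_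
  filter_upwards [hF] with z ⟨hz, e⟩
  simp only [covectorInTrivialization, e, differential_germ ι hz, inTangentCoordinates,
    ContinuousLinearMap.inCoordinates]
  rw [TangentBundle.continuousLinearMapAt_model_space]
  rfl

/-! ### Local lifts -/

section Lift

variable {ι} (hι : Manifold.IsImmersion 𝓘(ℂ, EX) 𝓘(ℂ, EY) ω ι)
include hι

omit [IsManifold 𝓘(ℂ, EX) ω X] in
/-- A holomorphic function on `X` extends locally to `X₁`. -/
theorem exists_regular_of_function {f : X → ℂ} {x : X} (hf : ContMDiffAt 𝓘(ℂ, EX) 𝓘(ℂ) ω f x) :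
    ∃ s : ∀ z, Stalk ι z, ∀ᶠ z in 𝓝 x, s ∈ regularAt ι z ∧ value ι z (s z) = f z := by
  obtain ⟨ρ, hρ, hρι⟩ := (hι.isImmersionAt x).exists_leftInverse
  have hx : ρ (ι x) = x := hρι.self_of_nhds
  have hF : f ∘ ρ ∈ holomorphicAt EY (ι x) :=
    ContMDiffAt.comp (ι x) (g := f) (f := ρ) (by rwa [hx]) hρ
  refine ⟨germ ι (f ∘ ρ), ?_⟩
  filter_upwards [eventually_mem_holomorphicAt ι hF, hρι] with z hz e
  refine ⟨germ_mem_regularAt ι hz, ?_⟩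
  rw [value_germ ι hz, Function.comp_apply, e]

/-- A holomorphic family of conormal covectors is locally the differential of a function which
vanishes on `X`. -/
theorem exists_germ_of_covector {θ : ∀ z, TangentSpace 𝓘(ℂ, EY) (ι z) →L[ℂ] ℂ} {x : X}
    (hθ : IsHolomorphicCovector ι x θ)
    (h0 : ∀ᶠ z in 𝓝 x, ∀ v : TangentSpace 𝓘(ℂ, EX) z,
      θ z (mfderiv 𝓘(ℂ, EX) 𝓘(ℂ, EY) ι z v) = 0) :
    ∃ s ∈ regularAt ι x, ∀ᶠ z in 𝓝 x, value ι z (s z) = 0 ∧ differential ι z (s z) = θ z := by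
  obtain ⟨ρ, hρ, hρι⟩ := (hι.isImmersionAt x).exists_leftInverse
  have hx : ρ (ι x) = x := hρι.self_of_nhds
  have hκ : ContMDiffAt 𝓘(ℂ, EY) 𝓘(ℂ, EY) ω (extChartAt 𝓘(ℂ, EY) (ι x)) (ι x) :=
    contMDiffAt_extChartAt
  have hιρ : ContMDiffAt 𝓘(ℂ, EY) 𝓘(ℂ, EY) ω (fun y => ι (ρ y)) (ι x) :=
    (ι.contMDiff.contMDiffAt (x := ρ (ι x))).comp (ι x) hρ
  have hκρ : ContMDiffAt 𝓘(ℂ, EY) 𝓘(ℂ, EY) ω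
      (fun y => extChartAt 𝓘(ℂ, EY) (ι x) (ι (ρ y))) (ι x) :=
    ContMDiffAt.comp (ι x) (g := extChartAt 𝓘(ℂ, EY) (ι x)) (f := fun y => ι (ρ y))
      (by rw [hx]; exact hκ) hιρ
  let A : Y → EY →L[ℂ] ℂ := fun y => covectorInTrivialization ι x θ (ρ y)
  have hA : ContMDiffAt 𝓘(ℂ, EY) 𝓘(ℂ, EY →L[ℂ] ℂ) ω A (ι x) :=
    ContMDiffAt.comp (ι x) (g := covectorInTrivialization ι x θ) (f := ρ) (by rwa [hx]) hρ
  let F : Y → ℂ := fun y => A y (extChartAt 𝓘(ℂ, EY) (ι x) y -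
    extChartAt 𝓘(ℂ, EY) (ι x) (ι (ρ y)))
  have hF : F ∈ holomorphicAt EY (ι x) := hA.clm_apply (hκ.sub hκρ)
  have hιc : Filter.Tendsto ι (𝓝 x) (𝓝 (ι x)) := ι.contMDiff.continuous.continuousAt
  have hρd : ∀ᶠ y in 𝓝 (ι x), MDifferentiableAt 𝓘(ℂ, EY) 𝓘(ℂ, EX) ρ y :=
    ((contMDiffAt_iff_contMDiffAt_nhds (by simp)).1 hρ).mono fun _ h =>
      h.mdifferentiableAt (by simp)
  refine ⟨germ ι F, germ_mem_regularAt ι hF, ?_⟩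
  filter_upwards [eventually_mem_holomorphicAt ι hF, hρι.eventually_nhds, h0,
    eventually_mem_chartAt_source ι x, hιc.eventually hA.eventually_mdifferentiableAt,
    hιc.eventually hρd] with z hz e hk hc hAd hρz
  have ez : ρ (ι z) = z := e.self_of_nhds
  rw [value_germ ι hz, differential_germ ι hz]
  refine ⟨by simp [F, ez], ?_⟩
  have hκz : MDifferentiableAt 𝓘(ℂ, EY) 𝓘(ℂ, EY) (extChartAt 𝓘(ℂ, EY) (ι x)) (ι z) :=
    mdifferentiableAt_extChartAt hc
  have hιz : MDifferentiableAt 𝓘(ℂ, EX) 𝓘(ℂ, EY) ι z :=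
    ι.contMDiff.contMDiffAt.mdifferentiableAt (by simp)
  let D : EX →L[ℂ] EY := (mfderiv 𝓘(ℂ, EY) 𝓘(ℂ, EY) (extChartAt 𝓘(ℂ, EY) (ι x)) (ι z)).comp
    (mfderiv 𝓘(ℂ, EX) 𝓘(ℂ, EY) ι z)
  have hD : HasMFDerivAt 𝓘(ℂ, EX) 𝓘(ℂ, EY) (extChartAt 𝓘(ℂ, EY) (ι x) ∘ ι) (ρ (ι z)) D := by
    rw [ez]
    exact hκz.hasMFDerivAt.comp z hιz.hasMFDerivAt
  have hd := hκz.hasMFDerivAt.sub (hD.comp (ι z) hρz.hasMFDerivAt)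
  have hp := (isBoundedBilinearMap_apply (𝕜 := ℂ) (E := EY) (F := ℂ)).hasFDerivAt
    (A (ι z), extChartAt 𝓘(ℂ, EY) (ι x) (ι z) - extChartAt 𝓘(ℂ, EY) (ι x) (ι (ρ (ι z))))
  have hAδ : HasMFDerivAt 𝓘(ℂ, EY) 𝓘(ℂ, (EY →L[ℂ] ℂ) × EY) (fun y => (A y,
      extChartAt 𝓘(ℂ, EY) (ι x) y - extChartAt 𝓘(ℂ, EY) (ι x) (ι (ρ y)))) (ι z) _ :=
    ⟨hAd.hasMFDerivAt.1.prodMk hd.1, hAd.hasMFDerivAt.2.prodMk hd.2⟩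
  have hm := (hp.hasMFDerivAt.comp (ι z) hAδ).mfderiv
  refine hm.trans ?_
  have hAz : A (ι z) = covectorInTrivialization ι x θ z := by simp only [A, ez]
  have hDz : ∀ w : EX, A (ι z) (D w) = 0 := fun w => by
    rw [hAz]
    exact (covectorInTrivialization_apply ι hc θ _).trans (hk w)
  have hAv : ∀ v : EY, A (ι z) (mfderiv 𝓘(ℂ, EY) 𝓘(ℂ, EY) (extChartAt 𝓘(ℂ, EY) (ι x)) (ι z) v) =
      θ z v := fun v => by
    rw [hAz]
    exact covectorInTrivialization_apply ι hc θ v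
  have hδz : extChartAt 𝓘(ℂ, EY) (ι x) (ι z) - extChartAt 𝓘(ℂ, EY) (ι x) (ι (ρ (ι z))) = 0 := by
    rw [ez, sub_self]
  refine ContinuousLinearMap.ext fun v : EY => ?_
  let B : EY →L[ℂ] EY →L[ℂ] ℂ := mfderiv 𝓘(ℂ, EY) 𝓘(ℂ, EY →L[ℂ] ℂ) A (ι z)
  let K : EY →L[ℂ] EY := mfderiv 𝓘(ℂ, EY) 𝓘(ℂ, EY) (extChartAt 𝓘(ℂ, EY) (ι x)) (ι z)
  let R : EY →L[ℂ] EX := mfderiv 𝓘(ℂ, EY) 𝓘(ℂ, EX) ρ (ι z)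
  have hfin : A (ι z) (K v - D (R v)) + B v (extChartAt 𝓘(ℂ, EY) (ι x) (ι z) -
      extChartAt 𝓘(ℂ, EY) (ι x) (ι (ρ (ι z)))) = θ z v := by
    rw [hδz, map_zero, add_zero, map_sub, hDz, sub_zero]
    exact hAv v
  exact hfin

end Lift

omit [IsManifold 𝓘(ℂ, EY) ω Y] [IsManifold 𝓘(ℂ, EX) ω X] in
theorem eventually_mem_regularAt {s : ∀ z, Stalk ι z} {x : X} (h : s ∈ regularAt ι x) :
    ∀ᶠ z in 𝓝 x, s ∈ regularAt ι z := by
  obtain ⟨F, hF⟩ := h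
  exact hF.eventually_nhds.mono fun z hz => ⟨F, hz⟩

variable {ι}

omit [IsManifold 𝓘(ℂ, EX) ω X] in
theorem eq_of_value_of_differential [FiniteDimensional ℂ EY]
    (hι : Manifold.IsImmersion 𝓘(ℂ, EX) 𝓘(ℂ, EY) ω ι) {x : X} {s t : ∀ z, Stalk ι z}
    (hs : s ∈ regularAt ι x) (ht : t ∈ regularAt ι x)
    (h0 : ∀ᶠ z in 𝓝 x, value ι z (s z) = value ι z (t z))
    (h1 : ∀ᶠ z in 𝓝 x, differential ι z (s z) = differential ι z (t z)) : s x = t x := by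
  suffices h : (s - t) x = 0 from sub_eq_zero.1 h
  refine eq_zero_of_value_of_differential hι (sub_mem hs ht) ?_ ?_
  · filter_upwards [h0] with z hz
    exact (RingHom.map_sub _ _ _).trans (sub_eq_zero.2 hz)
  · filter_upwards [h1] with z hz
    refine ContinuousLinearMap.ext fun v => ?_
    change differentialApply ι v (s z - t z) = 0
    exact (AddMonoidHom.map_sub _ _ _).trans (sub_eq_zero.2 (DFunLike.congr_fun hz v))

/-- A holomorphic family of conormal covectors over an open set is the differential of a unique
section of the ideal sheaf modulo its square. -/
theorem exists_section_of_covector [FiniteDimensional ℂ EY]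
    (hι : Manifold.IsImmersion 𝓘(ℂ, EX) 𝓘(ℂ, EY) ω ι) (U : Opens X)
    {θ : ∀ z, TangentSpace 𝓘(ℂ, EY) (ι z) →L[ℂ] ℂ}
    (hθ : ∀ x ∈ U, IsHolomorphicCovector ι x θ)
    (h0 : ∀ x ∈ U, ∀ v : TangentSpace 𝓘(ℂ, EX) x, θ x (mfderiv 𝓘(ℂ, EX) 𝓘(ℂ, EY) ι x v) = 0) :
    ∃ s : ∀ z, Stalk ι z, ∀ x ∈ U, s ∈ regularAt ι x ∧ value ι x (s x) = 0 ∧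
      differential ι x (s x) = θ x := by
  classical
  have h : ∀ x : X, ∃ s : ∀ z, Stalk ι z, x ∈ U → s ∈ regularAt ι x ∧
      ∀ᶠ z in 𝓝 x, value ι z (s z) = 0 ∧ differential ι z (s z) = θ z := fun x => by
    by_cases hx : x ∈ U
    · have h0' : ∀ᶠ z in 𝓝 x, ∀ v : TangentSpace 𝓘(ℂ, EX) z,
          θ z (mfderiv 𝓘(ℂ, EX) 𝓘(ℂ, EY) ι z v) = 0 := by
        filter_upwards [U.isOpen.mem_nhds hx] with z hz using h0 z hz
      obtain ⟨s, hs, hs'⟩ := exists_germ_of_covector hι (hθ x hx) h0'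
      exact ⟨s, fun _ => ⟨hs, hs'⟩⟩
    · exact ⟨0, fun h => (hx h).elim⟩
  choose s hs using h
  refine ⟨fun z => s z z, fun x hx => ⟨?_, (hs x hx).2.self_of_nhds⟩⟩
  refine regularAt_congr ι (hs x hx).1 ?_
  filter_upwards [U.isOpen.mem_nhds hx, (hs x hx).2.eventually_nhds,
    eventually_mem_regularAt ι (hs x hx).1] with z hz h1 h2
  refine eq_of_value_of_differential hι h2 (hs z hz).1 ?_ ?_
  · filter_upwards [h1, (hs z hz).2] with y hy hy'
    rw [hy.1, hy'.1]
  · filter_upwards [h1, (hs z hz).2] with y hy hy'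
    rw [hy.2, hy'.2]

end Covectors

section Frames

variable {V : Type*} [AddCommGroup V] [Module ℂ V] [TopologicalSpace V] {r : ℕ}

theorem matrixIn_comp (φ χ ψ : V ≃L[ℂ] (Fin r → ℂ)) (S T : V →L[ℂ] V) :
    matrixIn φ ψ (S.comp T) = matrixIn φ χ S * matrixIn χ ψ T := by
  rw [matrixIn, matrixIn, matrixIn, ← LinearMap.toMatrix'_comp]
  congr 1
  refine LinearMap.ext fun v => ?_
  simp

theorem matrixIn_change (φ φ' ψ ψ' : V ≃L[ℂ] (Fin r → ℂ)) (T : V →L[ℂ] V) :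
    matrixIn φ' φ (.id ℂ V) * matrixIn φ ψ T * matrixIn ψ ψ' (.id ℂ V) = matrixIn φ' ψ' T := by
  rw [← matrixIn_comp, ← matrixIn_comp]
  rfl

theorem matrixIn_left (φ φ' ψ : V ≃L[ℂ] (Fin r → ℂ)) (T : V →L[ℂ] V) :
    matrixIn φ' φ (.id ℂ V) * matrixIn φ ψ T = matrixIn φ' ψ T := by
  rw [← matrixIn_comp]
  rfl

theorem matrixIn_right (φ ψ ψ' : V ≃L[ℂ] (Fin r → ℂ)) (T : V →L[ℂ] V) :
    matrixIn φ ψ T * matrixIn ψ ψ' (.id ℂ V) = matrixIn φ ψ' T := by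
  rw [← matrixIn_comp]
  rfl

theorem matrixIn_injective (φ ψ : V ≃L[ℂ] (Fin r → ℂ)) :
    Function.Injective (matrixIn φ ψ) := fun S T h => by
  have h' := LinearMap.toMatrix'.injective h
  ext v
  have := LinearMap.congr_fun h' (ψ v)
  simpa using this

theorem matrixIn_zero (φ ψ : V ≃L[ℂ] (Fin r → ℂ)) : matrixIn φ ψ 0 = 0 := by
  rw [matrixIn, ← LinearMap.toMatrix'.map_zero]
  congr 1
  ext1 v
  simp

variable [IsTopologicalAddGroup V]

theorem matrixIn_add (φ ψ : V ≃L[ℂ] (Fin r → ℂ)) (S T : V →L[ℂ] V) :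
    matrixIn φ ψ (S + T) = matrixIn φ ψ S + matrixIn φ ψ T := by
  rw [matrixIn, matrixIn, matrixIn, ← map_add]
  congr 1
  refine LinearMap.ext fun v => ?_
  simp

theorem matrixIn_neg (φ ψ : V ≃L[ℂ] (Fin r → ℂ)) (S : V →L[ℂ] V) :
    matrixIn φ ψ (-S) = -matrixIn φ ψ S := by
  rw [eq_neg_iff_add_eq_zero, ← matrixIn_add, neg_add_cancel, matrixIn_zero]

theorem matrixIn_sub (φ ψ : V ≃L[ℂ] (Fin r → ℂ)) (S T : V →L[ℂ] V) :
    matrixIn φ ψ (S - T) = matrixIn φ ψ S - matrixIn φ ψ T := by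
  rw [sub_eq_add_neg, matrixIn_add, matrixIn_neg, sub_eq_add_neg]

/-- The entry of an endomorphism of `ℂ ^ r`. -/
noncomputable def entry (i j : Fin r) : ((Fin r → ℂ) →L[ℂ] (Fin r → ℂ)) →L[ℂ] ℂ :=
  (ContinuousLinearMap.proj (R := ℂ) (φ := fun _ : Fin r => ℂ) i).comp
    (ContinuousLinearMap.apply ℂ (Fin r → ℂ) (Pi.single j 1))

/-- The elementary endomorphism of `ℂ ^ r`. -/
noncomputable def elementary (i j : Fin r) : (Fin r → ℂ) →L[ℂ] (Fin r → ℂ) :=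
  (ContinuousLinearMap.proj (R := ℂ) (φ := fun _ : Fin r => ℂ) j).smulRight (Pi.single i 1)

theorem sum_entry_smul_elementary (T : (Fin r → ℂ) →L[ℂ] (Fin r → ℂ)) :
    ∑ i, ∑ j, entry i j T • elementary i j = T := by
  refine ContinuousLinearMap.ext fun w => ?_
  ext l
  have e : T w l = ∑ j, w j * T (Pi.single j 1) l := by
    conv_lhs => rw [pi_eq_sum_univ' w]
    simp [Finset.sum_apply]
  rw [e]
  simp [entry, elementary, Finset.sum_apply, Pi.single_apply, mul_comm]

theorem entry_sum_smul_elementary (c : Fin r → Fin r → ℂ) (k l : Fin r) :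
    entry k l (∑ i, ∑ j, c i j • elementary i j) = c k l := by
  have : ∀ i j, (if j = l then (Pi.single i 1 : Fin r → ℂ) else 0) k =
      if j = l then (if k = i then 1 else 0) else 0 := fun i j => by
    split_ifs <;> simp_all
  simp [entry, elementary, Pi.single_apply, this]

variable [ContinuousSMul ℂ V]

theorem entry_arrowCongr (φ ψ : V ≃L[ℂ] (Fin r → ℂ)) (T : V →L[ℂ] V) (i j : Fin r) :
    entry i j (ψ.arrowCongr φ T) = matrixIn φ ψ T i j := by
  simp [entry, matrixIn, LinearMap.toMatrix'_apply]

variable {T : Type*} [AddCommGroup T] [Module ℂ T] [TopologicalSpace T]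

/-- The entry of the matrix of an endomorphism-valued form. -/
noncomputable def formEntry (φ ψ : V ≃L[ℂ] (Fin r → ℂ)) (S : T →L[ℂ] (V →L[ℂ] V)) (i j : Fin r) :
    T →L[ℂ] ℂ :=
  (entry i j).comp (((ψ.arrowCongr φ : (V →L[ℂ] V) ≃L[ℂ] _) :
    (V →L[ℂ] V) →L[ℂ] ((Fin r → ℂ) →L[ℂ] (Fin r → ℂ))).comp S)

theorem formEntry_apply (φ ψ : V ≃L[ℂ] (Fin r → ℂ)) (S : T →L[ℂ] (V →L[ℂ] V)) (i j : Fin r)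
    (v : T) : formEntry φ ψ S i j v = matrixIn φ ψ (S v) i j :=
  entry_arrowCongr φ ψ (S v) i j

/-- The endomorphism-valued form with given entries. -/
noncomputable def formOfEntries (φ ψ : V ≃L[ℂ] (Fin r → ℂ)) (Θ : Fin r → Fin r → T →L[ℂ] ℂ) :
    T →L[ℂ] (V →L[ℂ] V) :=
  (((ψ.arrowCongr φ).symm : _ ≃L[ℂ] (V →L[ℂ] V)) :
    ((Fin r → ℂ) →L[ℂ] (Fin r → ℂ)) →L[ℂ] (V →L[ℂ] V)).comp
    (∑ i, ∑ j, (Θ i j).smulRight (elementary i j))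

theorem formEntry_formOfEntries (φ ψ : V ≃L[ℂ] (Fin r → ℂ)) (Θ : Fin r → Fin r → T →L[ℂ] ℂ)
    (i j : Fin r) : formEntry φ ψ (formOfEntries φ ψ Θ) i j = Θ i j := by
  refine ContinuousLinearMap.ext fun v => ?_
  rw [formEntry, formOfEntries]
  simp only [ContinuousLinearMap.comp_apply, ContinuousLinearEquiv.coe_coe,
    ContinuousLinearEquiv.apply_symm_apply, sum_apply, ContinuousLinearMap.smulRight_apply]
  exact entry_sum_smul_elementary (fun i j => Θ i j v) i j

theorem matrixIn_formOfEntries (φ ψ : V ≃L[ℂ] (Fin r → ℂ)) (Θ : Fin r → Fin r → T →L[ℂ] ℂ)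
    (v : T) : matrixIn φ ψ (formOfEntries φ ψ Θ v) = Matrix.of fun i j => Θ i j v := by
  ext i j
  rw [← formEntry_apply, formEntry_formOfEntries]
  rfl

end Frames

theorem eventually_mem_baseSet {B : Type*} [TopologicalSpace B] (F : Type*) [TopologicalSpace F]
    (E : B → Type*) [∀ x, TopologicalSpace (E x)] [TopologicalSpace (TotalSpace F E)]
    [FiberBundle F E] (x : B) : ∀ᶠ z in 𝓝 x, z ∈ (trivializationAt F E x).baseSet :=
  (trivializationAt F E x).open_baseSet.mem_nhds (mem_baseSet_trivializationAt F E x)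

section NormedSpaces

variable {EX F G H : Type*} [NormedAddCommGroup EX] [NormedSpace ℂ EX] [NormedAddCommGroup F]
  [NormedSpace ℂ F] [NormedAddCommGroup G] [NormedSpace ℂ G] [NormedAddCommGroup H]
  [NormedSpace ℂ H] {X : Type*} [TopologicalSpace X] [ChartedSpace EX X]

theorem contMDiffAt_comp_comp {a b : X → F →L[ℂ] F} {T : X → G →L[ℂ] (F →L[ℂ] F)} {x : X}
    (ha : ContMDiffAt 𝓘(ℂ, EX) 𝓘(ℂ, F →L[ℂ] F) ω a x)
    (hb : ContMDiffAt 𝓘(ℂ, EX) 𝓘(ℂ, F →L[ℂ] F) ω b x)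
    (hT : ContMDiffAt 𝓘(ℂ, EX) 𝓘(ℂ, G →L[ℂ] (F →L[ℂ] F)) ω T x) :
    ContMDiffAt 𝓘(ℂ, EX) 𝓘(ℂ, G →L[ℂ] (F →L[ℂ] F)) ω
      (fun z => ((a z).postcomp F).comp (((b z).precomp F).comp (T z))) x := by
  have h1 : ContMDiffAt 𝓘(ℂ, EX) 𝓘(ℂ, (F →L[ℂ] F) →L[ℂ] (F →L[ℂ] F)) ω
      (fun z => (a z).postcomp F) x := ContMDiffAt.clm_postcomp (F₁ := F) ha
  have h2 : ContMDiffAt 𝓘(ℂ, EX) 𝓘(ℂ, (F →L[ℂ] F) →L[ℂ] (F →L[ℂ] F)) ω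
      (fun z => (b z).precomp F) x := ContMDiffAt.clm_precomp (F₃ := F) hb
  have h3 : ContMDiffAt 𝓘(ℂ, EX) 𝓘(ℂ, G →L[ℂ] (F →L[ℂ] F)) ω
      (fun z => ((b z).precomp F).comp (T z)) x := ContMDiffAt.clm_comp h2 hT
  exact ContMDiffAt.clm_comp h1 h3

theorem contMDiffAt_clm_iff_coordinates {κ : Type*} [Fintype κ] (ε : κ → H →L[ℂ] ℂ) (m : κ → H)
    (hε : ∀ y, ∑ k, ε k y • m k = y) {T : X → G →L[ℂ] H} {x : X} :
    ContMDiffAt 𝓘(ℂ, EX) 𝓘(ℂ, G →L[ℂ] H) ω T x ↔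
      ∀ k, ContMDiffAt 𝓘(ℂ, EX) 𝓘(ℂ, G →L[ℂ] ℂ) ω (fun z => (ε k).comp (T z)) x := by
  constructor
  · intro h k
    exact contMDiffAt_const.clm_comp (g := fun _ => ε k) h
  · intro h
    have e : T = fun z => ∑ k, (ContinuousLinearMap.smulRightL ℂ G H).flip (m k)
        ((ε k).comp (T z)) := by
      ext1 z
      refine ContinuousLinearMap.ext fun v => ?_
      rw [← hε (T z v)]
      simp only [sum_apply]
      rfl
    rw [e]
    exact ContMDiffAt.sum fun k _ =>
      (((ContinuousLinearMap.smulRightL ℂ G H).flip (m k)).contMDiff (n := ω)).contMDiffAt.comp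
        x (h k)

end NormedSpaces

section HolomorphicFrames

variable {EX EY : Type*} [NormedAddCommGroup EX] [NormedSpace ℂ EX]
  [NormedAddCommGroup EY] [NormedSpace ℂ EY]
  {X Y : Type*} [TopologicalSpace X] [ChartedSpace EX X]
  [TopologicalSpace Y] [ChartedSpace EY Y]
  {ι : C^ω⟮𝓘(ℂ, EX), X; 𝓘(ℂ, EY), Y⟯} {r : ℕ}
  {E : X → Type*} [∀ x, AddCommGroup (E x)] [∀ x, Module ℂ (E x)] [∀ x, TopologicalSpace (E x)]
  [TopologicalSpace (TotalSpace (Fin r → ℂ) E)] [FiberBundle (Fin r → ℂ) E]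

/-! ### Holomorphic frames -/

theorem contMDiffAt_of_entry {T : X → (Fin r → ℂ) →L[ℂ] (Fin r → ℂ)} {x : X}
    (h : ∀ i j, ContMDiffAt 𝓘(ℂ, EX) 𝓘(ℂ) ω (fun z => entry i j (T z)) x) :
    ContMDiffAt 𝓘(ℂ, EX) 𝓘(ℂ, (Fin r → ℂ) →L[ℂ] (Fin r → ℂ)) ω T x := by
  have e : T = fun z => ∑ i, ∑ j, entry i j (T z) • elementary i j :=
    funext fun z => (sum_entry_smul_elementary (T z)).symm
  rw [e]
  exact ContMDiffAt.sum fun i _ => ContMDiffAt.sum fun j _ => (h i j).smul contMDiffAt_const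

variable (EX) in
/-- The family of frames is holomorphic near `x`. -/
def IsHolomorphicFrame (φ : ∀ x, E x ≃L[ℂ] (Fin r → ℂ)) (x : X) : Prop :=
  ∀ w : Fin r → ℂ, ContMDiffAt 𝓘(ℂ, EX) (𝓘(ℂ, EX).prod 𝓘(ℂ, Fin r → ℂ)) ω
    (fun z => TotalSpace.mk' (Fin r → ℂ) z ((φ z).symm w)) x

variable [VectorBundle ℂ (Fin r → ℂ) E]

/-- The change of coordinates from a frame to the trivialization around `x`. -/
noncomputable def frameToTrivialization (x : X) (φ : ∀ x, E x ≃L[ℂ] (Fin r → ℂ)) (z : X) :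
    (Fin r → ℂ) →L[ℂ] (Fin r → ℂ) :=
  ((trivializationAt (Fin r → ℂ) E x).continuousLinearMapAt ℂ z).comp
    ((φ z).symm : (Fin r → ℂ) →L[ℂ] E z)

/-- The change of coordinates from the trivialization around `x` to a frame. -/
noncomputable def trivializationToFrame (x : X) (φ : ∀ x, E x ≃L[ℂ] (Fin r → ℂ)) (z : X) :
    (Fin r → ℂ) →L[ℂ] (Fin r → ℂ) :=
  (φ z : E z →L[ℂ] (Fin r → ℂ)).comp ((trivializationAt (Fin r → ℂ) E x).symmL ℂ z)

theorem contMDiffAt_frameToTrivialization {φ : ∀ x, E x ≃L[ℂ] (Fin r → ℂ)} {x : X}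
    (hφ : IsHolomorphicFrame EX φ x) :
    ContMDiffAt 𝓘(ℂ, EX) 𝓘(ℂ, (Fin r → ℂ) →L[ℂ] (Fin r → ℂ)) ω (frameToTrivialization x φ) x := by
  refine contMDiffAt_of_entry fun i j => ?_
  have h := (Bundle.contMDiffAt_section x).1 (hφ (Pi.single j 1))
  have h' := ((ContinuousLinearMap.proj (R := ℂ) (φ := fun _ : Fin r => ℂ) i).contMDiff
    (n := ω)).contMDiffAt.comp x h
  refine h'.congr_of_eventuallyEq ?_
  filter_upwards [eventually_mem_baseSet (Fin r → ℂ) E x] with z hz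
  simp [entry, frameToTrivialization, Trivialization.coe_linearMapAt_of_mem _ hz]

theorem contMDiffAt_trivializationToFrame {φ : ∀ x, E x ≃L[ℂ] (Fin r → ℂ)} {x : X}
    (hφ : IsHolomorphicFrame EX φ x) :
    ContMDiffAt 𝓘(ℂ, EX) 𝓘(ℂ, (Fin r → ℂ) →L[ℂ] (Fin r → ℂ)) ω (trivializationToFrame x φ) x := by
  have key : ∀ z (hz : z ∈ (trivializationAt (Fin r → ℂ) E x).baseSet),
      frameToTrivialization x φ z = ((φ z).symm.trans
        ((trivializationAt (Fin r → ℂ) E x).continuousLinearEquivAt ℂ z hz) :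
          (Fin r → ℂ) →L[ℂ] (Fin r → ℂ)) := fun z hz => by
    ext1 w
    simp [frameToTrivialization, Trivialization.coe_linearMapAt_of_mem _ hz]
  have h1 : ContDiffAt ℂ ω ContinuousLinearMap.inverse (frameToTrivialization x φ x) := by
    rw [key x (mem_baseSet_trivializationAt _ E x)]
    exact contDiffAt_map_inverse _
  refine (h1.comp_contMDiffAt (contMDiffAt_frameToTrivialization hφ)).congr_of_eventuallyEq ?_
  filter_upwards [eventually_mem_baseSet (Fin r → ℂ) E x] with z hz
  rw [Function.comp_apply, key z hz, ContinuousLinearMap.inverse_equiv]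
  ext1 w
  exact congrArg (φ z)
    (Trivialization.symmL_apply (R := ℂ) (trivializationAt (Fin r → ℂ) E x) hz w)

theorem trivializationToFrame_comp {φ ψ : ∀ x, E x ≃L[ℂ] (Fin r → ℂ)} {x z : X}
    (hz : z ∈ (trivializationAt (Fin r → ℂ) E x).baseSet) (w : Fin r → ℂ) :
    trivializationToFrame x φ z (frameToTrivialization x ψ z w) = φ z ((ψ z).symm w) := by
  simp [trivializationToFrame, frameToTrivialization, Trivialization.symm_apply_apply_mk,
    Trivialization.coe_linearMapAt_of_mem _ hz, hz]

variable [∀ x, IsTopologicalAddGroup (E x)] [∀ x, ContinuousSMul ℂ (E x)]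

/-- The transition matrix of two holomorphic frames is holomorphic. -/
theorem contMDiffAt_matrixIn {φ ψ : ∀ x, E x ≃L[ℂ] (Fin r → ℂ)} {x : X}
    (hφ : IsHolomorphicFrame EX φ x) (hψ : IsHolomorphicFrame EX ψ x) (i j : Fin r) :
    ContMDiffAt 𝓘(ℂ, EX) 𝓘(ℂ) ω (fun z => matrixIn (φ z) (ψ z) (.id ℂ (E z)) i j) x := by
  have h := ((entry i j).contMDiff (n := ω)).contMDiffAt.comp x
    ((contMDiffAt_trivializationToFrame hφ).clm_comp (contMDiffAt_frameToTrivialization hψ))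
  refine h.congr_of_eventuallyEq ?_
  filter_upwards [eventually_mem_baseSet (Fin r → ℂ) E x] with z hz
  rw [← entry_arrowCongr]
  refine congrArg (entry i j) ?_
  ext1 w
  exact (trivializationToFrame_comp hz w).symm

variable [IsManifold 𝓘(ℂ, EY) ω Y]

theorem inTrivializations_apply {x z : X} (hz : z ∈ (trivializationAt (Fin r → ℂ) E x).baseSet)
    (s : ∀ z, FormFiber ι E z) (v : EY) (w : Fin r → ℂ) :
    inTrivializations ι r E x s z v w =
      (trivializationAt (Fin r → ℂ) E x).continuousLinearMapAt ℂ z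
        (s z ((trivializationAt EY (TangentSpace 𝓘(ℂ, EY) : Y → Type _) (ι x)).symmL ℂ (ι z) v)
          ((trivializationAt (Fin r → ℂ) E x).symmL ℂ z w)) := by
  have e := Trivialization.coe_linearMapAt_of_mem (R := ℂ)
    (trivializationAt ((Fin r → ℂ) →L[ℂ] (Fin r → ℂ)) (fun z => E z →L[ℂ] E z) x) (b := z)
    (by exact ⟨hz, hz⟩)
  exact DFunLike.congr_fun (congrFun e (s z
    ((trivializationAt EY (TangentSpace 𝓘(ℂ, EY) : Y → Type _) (ι x)).symmL ℂ (ι z) v))) w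

/-- A form with values in the endomorphisms of `E`, read in two frames. -/
noncomputable def inFrames (φ ψ : ∀ x, E x ≃L[ℂ] (Fin r → ℂ)) (x : X) (s : ∀ z, FormFiber ι E z)
    (z : X) : EY →L[ℂ] ((Fin r → ℂ) →L[ℂ] (Fin r → ℂ)) :=
  ((((ψ z).arrowCongr (φ z) : (E z →L[ℂ] E z) ≃L[ℂ] _) :
    (E z →L[ℂ] E z) →L[ℂ] ((Fin r → ℂ) →L[ℂ] (Fin r → ℂ))).comp (s z)).comp
    ((trivializationAt EY (TangentSpace 𝓘(ℂ, EY) : Y → Type _) (ι x)).symmL ℂ (ι z))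

theorem mem_formSheaf_iff_inFrames {φ ψ : ∀ x, E x ≃L[ℂ] (Fin r → ℂ)} {x : X}
    (hφ : IsHolomorphicFrame EX φ x) (hψ : IsHolomorphicFrame EX ψ x) {s : ∀ z, FormFiber ι E z} :
    s ∈ formSheaf ι r E x ↔
      ContMDiffAt 𝓘(ℂ, EX) 𝓘(ℂ, EY →L[ℂ] ((Fin r → ℂ) →L[ℂ] (Fin r → ℂ))) ω
        (inFrames φ ψ x s) x := by
  change ContMDiffAt _ _ _ _ _ ↔ _
  constructor
  · intro h
    refine (contMDiffAt_comp_comp (contMDiffAt_trivializationToFrame hφ)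
      (contMDiffAt_frameToTrivialization hψ) h).congr_of_eventuallyEq ?_
    filter_upwards [eventually_mem_baseSet (Fin r → ℂ) E x] with z hz
    refine ContinuousLinearMap.ext fun v => ContinuousLinearMap.ext fun w => ?_
    change _ = trivializationToFrame x φ z
      (inTrivializations ι r E x s z v (frameToTrivialization x ψ z w))
    rw [inTrivializations_apply hz]
    simp only [trivializationToFrame, frameToTrivialization, ContinuousLinearMap.comp_apply]
    rw [Trivialization.symmL_continuousLinearMapAt _ hz,
      Trivialization.symmL_continuousLinearMapAt _ hz]
    rfl
  · intro h
    refine (contMDiffAt_comp_comp (contMDiffAt_frameToTrivialization hφ)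
      (contMDiffAt_trivializationToFrame hψ) h).congr_of_eventuallyEq ?_
    filter_upwards [eventually_mem_baseSet (Fin r → ℂ) E x] with z hz
    refine ContinuousLinearMap.ext fun v => ContinuousLinearMap.ext fun w => ?_
    change _ = frameToTrivialization x φ z
      (inFrames φ ψ x s z v (trivializationToFrame x ψ z w))
    rw [inTrivializations_apply hz]
    simp [trivializationToFrame, frameToTrivialization, inFrames]

theorem mem_formSheaf_iff {φ ψ : ∀ x, E x ≃L[ℂ] (Fin r → ℂ)} {x : X}
    (hφ : IsHolomorphicFrame EX φ x) (hψ : IsHolomorphicFrame EX ψ x) {s : ∀ z, FormFiber ι E z} :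
    s ∈ formSheaf ι r E x ↔
      ∀ i j, IsHolomorphicCovector ι x fun z => formEntry (φ z) (ψ z) (s z) i j := by
  rw [mem_formSheaf_iff_inFrames hφ hψ, contMDiffAt_clm_iff_coordinates
    (fun k : Fin r × Fin r => entry k.1 k.2) (fun k => elementary k.1 k.2) fun y => by
      rw [Fintype.sum_prod_type]
      exact sum_entry_smul_elementary y]
  exact Prod.forall

end HolomorphicFrames

section CechLemmas

variable {X : Type*} [TopologicalSpace X] {A : X → Type*} [∀ x, AddCommGroup (A x)]
  {S : X → AddSubgroup (∀ x, A x)}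

theorem H1.exists_mk_eq (γ : H1 S) : ∃ (U : PointCover X) (c : cocycles S U), H1.mk c = γ := by
  obtain ⟨⟨c, U, hc⟩, rfl⟩ := QuotientAddGroup.mk_surjective γ
  exact ⟨U, ⟨c, hc⟩, rfl⟩

theorem H1.mk_eq_mk {U V : PointCover X} (c : cocycles S U) (c' : cocycles S V) :
    H1.mk c = H1.mk c' ↔ c.1 - c'.1 ∈ allCoboundaries S :=
  QuotientAddGroup.eq_iff_sub_mem.trans Iff.rfl

/-- The restriction of a cocycle to a finer cover. -/
def restrictCocycle {U W : PointCover X} (h : W.Refines U) (c : cocycles S U) : cocycles S W :=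
  ⟨c.1, cocycles_anti h c.2⟩

theorem H1.mk_restrictCocycle {U W : PointCover X} (h : W.Refines U) (c : cocycles S U) :
    H1.mk (restrictCocycle h c) = H1.mk c := by
  rw [H1.mk_eq_mk]
  change c.1 - c.1 ∈ _
  rw [sub_self]
  exact zero_mem _

theorem H1.mk_add {U : PointCover X} (c c' : cocycles S U) :
    H1.mk (c + c') = H1.mk c + H1.mk c' :=
  QuotientAddGroup.mk_add _ (⟨c.1, U, c.2⟩ : allCocycles S) ⟨c'.1, U, c'.2⟩

theorem H1.mk_zero {U : PointCover X} : H1.mk (0 : cocycles S U) = 0 :=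
  QuotientAddGroup.mk_zero _

end CechLemmas

section MatrixLemmas

variable {EX EY : Type*} [NormedAddCommGroup EX] [NormedSpace ℂ EX]
  [NormedAddCommGroup EY] [NormedSpace ℂ EY]
  {X Y : Type*} [TopologicalSpace X] [ChartedSpace EX X]
  [TopologicalSpace Y] [ChartedSpace EY Y]
  {ι : C^ω⟮𝓘(ℂ, EX), X; 𝓘(ℂ, EY), Y⟯} {r : ℕ}

/-! ### Matrices of elements of the stalks -/

/-- The value of a matrix of elements of the stalk. -/
noncomputable def valueMatrix {x : X} (M : Matrix (Fin r) (Fin r) (Stalk ι x)) :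
    Matrix (Fin r) (Fin r) ℂ :=
  M.map (value ι x)

/-- The differential of a matrix of elements of the stalk, evaluated at a tangent vector. -/
noncomputable def differentialMatrix {x : X} (v : TangentSpace 𝓘(ℂ, EY) (ι x))
    (M : Matrix (Fin r) (Fin r) (Stalk ι x)) : Matrix (Fin r) (Fin r) ℂ :=
  M.map (differentialApply ι v)

theorem valueMatrix_mul {x : X} (M N : Matrix (Fin r) (Fin r) (Stalk ι x)) :
    valueMatrix (M * N) = valueMatrix M * valueMatrix N := Matrix.map_mul

theorem valueMatrix_add {x : X} (M N : Matrix (Fin r) (Fin r) (Stalk ι x)) :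
    valueMatrix (M + N) = valueMatrix M + valueMatrix N :=
  Matrix.map_add _ (RingHom.map_add _) _ _

theorem valueMatrix_sub {x : X} (M N : Matrix (Fin r) (Fin r) (Stalk ι x)) :
    valueMatrix (M - N) = valueMatrix M - valueMatrix N :=
  Matrix.map_sub _ (RingHom.map_sub _) _ _

theorem valueMatrix_one {x : X} : valueMatrix (1 : Matrix (Fin r) (Fin r) (Stalk ι x)) = 1 :=
  Matrix.map_one _ (RingHom.map_zero _) (RingHom.map_one _)

theorem differentialMatrix_add {x : X} (v : TangentSpace 𝓘(ℂ, EY) (ι x))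
    (M N : Matrix (Fin r) (Fin r) (Stalk ι x)) :
    differentialMatrix v (M + N) = differentialMatrix v M + differentialMatrix v N :=
  Matrix.map_add _ (AddMonoidHom.map_add _) _ _

theorem differentialMatrix_sub {x : X} (v : TangentSpace 𝓘(ℂ, EY) (ι x))
    (M N : Matrix (Fin r) (Fin r) (Stalk ι x)) :
    differentialMatrix v (M - N) = differentialMatrix v M - differentialMatrix v N :=
  Matrix.map_sub _ (AddMonoidHom.map_sub _) _ _

theorem differentialMatrix_mul {x : X} (v : TangentSpace 𝓘(ℂ, EY) (ι x))
    (M N : Matrix (Fin r) (Fin r) (Stalk ι x)) :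
    differentialMatrix v (M * N) =
      valueMatrix M * differentialMatrix v N + differentialMatrix v M * valueMatrix N := by
  ext i j
  have h : ∀ k, differentialApply ι v (M i k * N k j) =
      value ι x (M i k) * differentialApply ι v (N k j) +
        differentialApply ι v (M i k) * value ι x (N k j) :=
    fun k => differentialApply_mul ι v _ _
  have e : differentialMatrix v (M * N) i j = ∑ k, differentialApply ι v (M i k * N k j) :=
    (congrArg (differentialApply ι v) Matrix.mul_apply).trans (map_sum _ _ _)
  rw [e, Matrix.add_apply, Matrix.mul_apply, Matrix.mul_apply, ← Finset.sum_add_distrib]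
  exact Finset.sum_congr rfl fun k _ => h k

theorem differentialMatrix_zero {x : X} (v : TangentSpace 𝓘(ℂ, EY) (ι x)) :
    differentialMatrix v (0 : Matrix (Fin r) (Fin r) (Stalk ι x)) = 0 := by
  simpa using differentialMatrix_sub v (0 : Matrix (Fin r) (Fin r) (Stalk ι x)) 0

theorem differentialMatrix_one {x : X} (v : TangentSpace 𝓘(ℂ, EY) (ι x)) :
    differentialMatrix v (1 : Matrix (Fin r) (Fin r) (Stalk ι x)) = 0 := by
  have h := differentialMatrix_mul v (1 : Matrix (Fin r) (Fin r) (Stalk ι x)) 1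
  rw [mul_one, valueMatrix_one, one_mul, mul_one] at h
  exact left_eq_add.1 h

variable (ι r) in
/-- The family of matrices is a section near `x`. -/
def RegularMatrix (M : ∀ z, Matrix (Fin r) (Fin r) (Stalk ι z)) (x : X) : Prop :=
  ∀ i j, (fun z => M z i j) ∈ regularAt ι x

theorem RegularMatrix.mul {x : X} {M N : ∀ z, Matrix (Fin r) (Fin r) (Stalk ι z)}
    (hM : RegularMatrix ι r M x) (hN : RegularMatrix ι r N x) :
    RegularMatrix ι r (fun z => M z * N z) x := regular_mul hM hN

theorem RegularMatrix.add {x : X} {M N : ∀ z, Matrix (Fin r) (Fin r) (Stalk ι z)}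
    (hM : RegularMatrix ι r M x) (hN : RegularMatrix ι r N x) :
    RegularMatrix ι r (fun z => M z + N z) x := fun i j => add_mem (hM i j) (hN i j)

theorem RegularMatrix.sub {x : X} {M N : ∀ z, Matrix (Fin r) (Fin r) (Stalk ι z)}
    (hM : RegularMatrix ι r M x) (hN : RegularMatrix ι r N x) :
    RegularMatrix ι r (fun z => M z - N z) x := fun i j => sub_mem (hM i j) (hN i j)

theorem RegularMatrix.one {x : X} : RegularMatrix ι r (fun _ => 1) x := regular_one

theorem regular_det {x : X} {n : ℕ} {M : ∀ z, Matrix (Fin n) (Fin n) (Stalk ι z)}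
    (hM : RegularMatrix ι n M x) : (fun z => (M z).det) ∈ regularAt ι x := by
  have e : (fun z => (M z).det) = ∑ σ : Equiv.Perm (Fin n),
      (Equiv.Perm.sign σ : ℤ) • ∏ i, fun z => M z (σ i) i := by
    ext1 z
    rw [Matrix.det_apply, Finset.sum_apply]
    refine Finset.sum_congr rfl fun σ _ => ?_
    simp [Units.smul_def]
  rw [e]
  exact sum_mem fun σ _ => zsmul_mem (prod_mem fun i _ => hM _ _) _

theorem regular_adjugate {x : X} {M : ∀ z, Matrix (Fin r) (Fin r) (Stalk ι z)}
    (hM : RegularMatrix ι r M x) : RegularMatrix ι r (fun z => (M z).adjugate) x := fun i j => by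
  simp only [Matrix.adjugate_apply]
  refine regular_det fun k l => ?_
  by_cases h : k = j
  · subst h
    simp only [Matrix.updateRow_self]
    by_cases h' : l = i
    · subst h'
      simp only [Pi.single_eq_same]
      exact one_mem (regularAt ι x)
    · simp only [Pi.single_eq_of_ne h']
      exact zero_mem (regularAt ι x)
  · simp only [Matrix.updateRow_ne h]
    exact hM k l

theorem isUnit_det_of_value {x : X} {M : Matrix (Fin r) (Fin r) (Stalk ι x)}
    (h : (valueMatrix M).det ≠ 0) : IsUnit M.det := by
  refine isUnit_of_value_ne_zero ι ?_
  rwa [RingHom.map_det]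

variable [IsManifold 𝓘(ℂ, EY) ω Y]

theorem RegularMatrix.inv {x : X} {M : ∀ z, Matrix (Fin r) (Fin r) (Stalk ι z)}
    (hM : RegularMatrix ι r M x) (h : (valueMatrix (M x)).det ≠ 0) :
    RegularMatrix ι r (fun z => (M z)⁻¹) x := fun i j => by
  have h' : value ι x (M x).det ≠ 0 := by rwa [RingHom.map_det]
  exact mul_mem (inverse_mem_regularAt ι (regular_det hM) h') (regular_adjugate hM i j)

theorem RegularMatrix.eq_zero [FiniteDimensional ℂ EY]
    (hι : Manifold.IsImmersion 𝓘(ℂ, EX) 𝓘(ℂ, EY) ω ι) {U : Opens X}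
    {M : ∀ z, Matrix (Fin r) (Fin r) (Stalk ι z)} (hM : ∀ x ∈ U, RegularMatrix ι r M x)
    (h0 : ∀ x ∈ U, valueMatrix (M x) = 0) (h1 : ∀ x ∈ U, ∀ v, differentialMatrix v (M x) = 0)
    {x : X} (hx : x ∈ U) : M x = 0 := by
  ext i j
  refine eq_zero_of_value_of_differential hι (hM x hx i j) ?_ ?_
  · filter_upwards [U.isOpen.mem_nhds hx] with z hz
    exact congrFun (congrFun (h0 z hz) i) j
  · filter_upwards [U.isOpen.mem_nhds hx] with z hz
    exact ContinuousLinearMap.ext fun v => congrFun (congrFun (h1 z hz v) i) j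

end MatrixLemmas

section FormLemmas

variable {EX EY : Type*} [NormedAddCommGroup EX] [NormedSpace ℂ EX]
  [NormedAddCommGroup EY] [NormedSpace ℂ EY]
  {X Y : Type*} [TopologicalSpace X] [ChartedSpace EX X] [IsManifold 𝓘(ℂ, EX) ω X]
  [TopologicalSpace Y] [ChartedSpace EY Y] [IsManifold 𝓘(ℂ, EY) ω Y]
  {ι : C^ω⟮𝓘(ℂ, EX), X; 𝓘(ℂ, EY), Y⟯} {r : ℕ}
  {E : X → Type*} [∀ x, AddCommGroup (E x)] [∀ x, Module ℂ (E x)] [∀ x, TopologicalSpace (E x)]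
  [∀ x, IsTopologicalAddGroup (E x)] [∀ x, ContinuousSMul ℂ (E x)]
  [TopologicalSpace (TotalSpace (Fin r → ℂ) E)] [FiberBundle (Fin r → ℂ) E]
  [VectorBundle ℂ (Fin r → ℂ) E]

/-- The form with values in the endomorphisms of `E` whose matrix is the differential of a given
matrix. -/
noncomputable def differentialForm (φ ψ : ∀ x, E x ≃L[ℂ] (Fin r → ℂ))
    (M : ∀ z, Matrix (Fin r) (Fin r) (Stalk ι z)) (z : X) : FormFiber ι E z :=
  formOfEntries (φ z) (ψ z) fun i j => differential ι z (M z i j)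

omit [IsManifold 𝓘(ℂ, EX) ω X] [IsManifold 𝓘(ℂ, EY) ω Y]
  [TopologicalSpace (TotalSpace (Fin r → ℂ) E)] [FiberBundle (Fin r → ℂ) E]
  [VectorBundle ℂ (Fin r → ℂ) E] in
theorem matrixIn_differentialForm (φ ψ : ∀ x, E x ≃L[ℂ] (Fin r → ℂ))
    (M : ∀ z, Matrix (Fin r) (Fin r) (Stalk ι z)) (z : X) (v : TangentSpace 𝓘(ℂ, EY) (ι z)) :
    matrixIn (φ z) (ψ z) (differentialForm φ ψ M z v) = differentialMatrix v (M z) :=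
  matrixIn_formOfEntries _ _ _ v

theorem differentialForm_mem_formSheaf {φ ψ : ∀ x, E x ≃L[ℂ] (Fin r → ℂ)} {x : X}
    (hφ : IsHolomorphicFrame EX φ x) (hψ : IsHolomorphicFrame EX ψ x)
    {M : ∀ z, Matrix (Fin r) (Fin r) (Stalk ι z)} (hM : RegularMatrix ι r M x) :
    differentialForm φ ψ M ∈ formSheaf ι r E x := by
  rw [mem_formSheaf_iff hφ hψ]
  intro i j
  have e : (fun z => formEntry (φ z) (ψ z) (differentialForm φ ψ M z) i j) =
      fun z => differential ι z (M z i j) :=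
    funext fun z => formEntry_formOfEntries _ _ _ i j
  rw [e]
  exact isHolomorphicCovector_differential ι (hM i j)

theorem differentialForm_mem_conormalSheaf {φ ψ : ∀ x, E x ≃L[ℂ] (Fin r → ℂ)} {U : Opens X}
    (hφ : ∀ x ∈ U, IsHolomorphicFrame EX φ x) (hψ : ∀ x ∈ U, IsHolomorphicFrame EX ψ x)
    {M : ∀ z, Matrix (Fin r) (Fin r) (Stalk ι z)} (hM : ∀ x ∈ U, RegularMatrix ι r M x)
    (h0 : ∀ x ∈ U, valueMatrix (M x) = 0) :
    differentialForm φ ψ M ∈ sectionsOver (conormalSheaf ι r E) U := by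
  refine mem_sectionsOver.2 fun x hx =>
    ⟨differentialForm_mem_formSheaf (hφ x hx) (hψ x hx) (hM x hx), ?_⟩
  filter_upwards [U.isOpen.mem_nhds hx] with z hz v
  refine matrixIn_injective (φ z) (ψ z) ?_
  rw [matrixIn_differentialForm, matrixIn_zero]
  ext i j
  refine differential_mfderiv_eq_zero ι (hM z hz i j) ?_ v
  filter_upwards [U.isOpen.mem_nhds hz] with y hy
  exact congrFun (congrFun (h0 y hy) i) j

/-- A conormal form with values in the endomorphisms of `E` is the differential of a matrix with
value zero. -/
theorem exists_matrix_of_form [FiniteDimensional ℂ EY]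
    (hι : Manifold.IsImmersion 𝓘(ℂ, EX) 𝓘(ℂ, EY) ω ι)
    {φ ψ : ∀ x, E x ≃L[ℂ] (Fin r → ℂ)} {U : Opens X}
    (hφ : ∀ x ∈ U, IsHolomorphicFrame EX φ x) (hψ : ∀ x ∈ U, IsHolomorphicFrame EX ψ x)
    {s : ∀ z, FormFiber ι E z} (hs : s ∈ sectionsOver (conormalSheaf ι r E) U) :
    ∃ M : ∀ z, Matrix (Fin r) (Fin r) (Stalk ι z), ∀ x ∈ U, RegularMatrix ι r M x ∧
      valueMatrix (M x) = 0 ∧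
      ∀ v, differentialMatrix v (M x) = matrixIn (φ x) (ψ x) (s x v) := by
  have hs' := mem_sectionsOver.1 hs
  have h : ∀ i j, ∃ t : ∀ z, Stalk ι z, ∀ x ∈ U, t ∈ regularAt ι x ∧ value ι x (t x) = 0 ∧
      differential ι x (t x) = formEntry (φ x) (ψ x) (s x) i j := fun i j => by
    refine exists_section_of_covector hι U
      (fun x hx => (mem_formSheaf_iff (hφ x hx) (hψ x hx)).1 (hs' x hx).1 i j) fun x hx v => ?_
    rw [formEntry_apply, (hs' x hx).2.self_of_nhds v, matrixIn_zero]
    rfl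
  choose t ht using h
  refine ⟨fun z => Matrix.of fun i j => t i j z, fun x hx => ⟨fun i j => (ht i j x hx).1,
    Matrix.ext fun i j => (ht i j x hx).2.1, fun v => Matrix.ext fun i j => ?_⟩⟩
  rw [← formEntry_apply, ← (ht i j x hx).2.2]
  rfl

omit [IsManifold 𝓘(ℂ, EX) ω X] in
theorem exists_matrix_of_frames (hι : Manifold.IsImmersion 𝓘(ℂ, EX) 𝓘(ℂ, EY) ω ι)
    {φ ψ : ∀ x, E x ≃L[ℂ] (Fin r → ℂ)} {x : X}
    (hφ : IsHolomorphicFrame EX φ x) (hψ : IsHolomorphicFrame EX ψ x) :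
    ∃ M : ∀ z, Matrix (Fin r) (Fin r) (Stalk ι z), ∀ᶠ z in 𝓝 x, RegularMatrix ι r M z ∧
      valueMatrix (M z) = matrixIn (φ z) (ψ z) (.id ℂ (E z)) := by
  choose t ht using fun i j => exists_regular_of_function hι (contMDiffAt_matrixIn hφ hψ i j)
  refine ⟨fun z => Matrix.of fun i j => t i j z, ?_⟩
  filter_upwards [Filter.eventually_all.2 fun i => Filter.eventually_all.2 fun j => ht i j]
    with z hz
  exact ⟨fun i j => (hz i j).1, Matrix.ext fun i j => (hz i j).2⟩

end FormLemmas

section CechEquality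

variable {X : Type*} [TopologicalSpace X] {A : X → Type*} [∀ x, AddCommGroup (A x)]
  {S T : X → AddSubgroup (∀ x, A x)}

theorem H1.mk_eq_of_sub {U V : PointCover X} (c : cocycles S U) (c' : cocycles S V)
    (W : PointCover X) (s : X → ∀ x, A x) (hs : ∀ a, s a ∈ sectionsOver S (W.nhd a))
    (h : ∀ a b, ∀ x ∈ W.nhd a ⊓ W.nhd b, c.1 a b x - c'.1 a b x = s a x - s b x) :
    H1.mk c = H1.mk c' :=
  (H1.mk_eq_mk c c').2 ⟨W, s, hs, h⟩

theorem H1.mk_eq_of_eq {U V : PointCover X} (c : cocycles S U) (c' : cocycles S V)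
    (W : PointCover X) (h : ∀ a b, ∀ x ∈ W.nhd a ⊓ W.nhd b, c.1 a b x = c'.1 a b x) :
    H1.mk c = H1.mk c' :=
  H1.mk_eq_of_sub c c' W 0 (fun _ => zero_mem _) fun a b x hx => by simp [h a b x hx]

theorem H1.mk_eq_zero {U : PointCover X} (c : cocycles S U) :
    H1.mk c = 0 ↔ c.1 ∈ allCoboundaries S := by
  rw [← H1.mk_zero (U := U), H1.mk_eq_mk]
  change c.1 - 0 ∈ _ ↔ _
  rw [sub_zero]

theorem H1.map_mk (h : ∀ x, S x ≤ T x) {U : PointCover X} (c : cocycles S U) :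
    H1.map h (H1.mk c) = H1.mk (⟨c.1, cocycles_mono h U c.2⟩ : cocycles T U) :=
  QuotientAddGroup.map_mk _ _ _ _ _

theorem cocycle_self {U : PointCover X} (c : cocycles S U) {a x : X} (hx : x ∈ U.nhd a) :
    c.1 a a x = 0 :=
  add_eq_left.1 (c.2.2 a a a x ⟨⟨hx, hx⟩, hx⟩)

end CechEquality

section Comparison

variable {EX EY : Type*} [NormedAddCommGroup EX] [NormedSpace ℂ EX]
  [NormedAddCommGroup EY] [NormedSpace ℂ EY]
  {X Y : Type*} [TopologicalSpace X] [ChartedSpace EX X]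
  [TopologicalSpace Y] [ChartedSpace EY Y]
  {ι : C^ω⟮𝓘(ℂ, EX), X; 𝓘(ℂ, EY), Y⟯} {r : ℕ}
  {E : X → Type*} [∀ x, AddCommGroup (E x)] [∀ x, Module ℂ (E x)] [∀ x, TopologicalSpace (E x)]
  [TopologicalSpace (TotalSpace (Fin r → ℂ) E)] [FiberBundle (Fin r → ℂ) E]

/-! ### Comparison of two extensions -/

theorem Extension.valueMatrix_trans (P : Extension ι r E) {a b x : X}
    (hx : x ∈ P.cover.nhd a ⊓ P.cover.nhd b) :
    valueMatrix (P.trans a b x) = matrixIn (P.frame a x) (P.frame b x) (.id ℂ (E x)) :=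
  P.g_eq a b x hx

theorem Extension.isHolomorphicFrame (P : Extension ι r E) {a x : X} (hx : x ∈ P.cover.nhd a) :
    IsHolomorphicFrame EX (P.frame a) x := P.frame_holomorphic a x hx

/-- Local isomorphisms from `Q` to `P` on the sets of an open cover which induce the identity of
`E`. -/
structure Comparison (P Q : Extension ι r E) where
  cover : PointCover X
  refines_left : cover.Refines P.cover
  refines_right : cover.Refines Q.cover
  H : X → ∀ x, Matrix (Fin r) (Fin r) (Stalk ι x)
  regular : ∀ a, ∀ x ∈ cover.nhd a, RegularMatrix ι r (H a) x
  value_eq : ∀ a, ∀ x ∈ cover.nhd a,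
    valueMatrix (H a x) = matrixIn (P.frame a x) (Q.frame a x) (.id ℂ (E x))

namespace Comparison

variable {P Q R : Extension ι r E}

/-- The failure of the local isomorphisms to agree on the intersections. -/
noncomputable def defect (T : Comparison P Q) (a b x : X) : Matrix (Fin r) (Fin r) (Stalk ι x) :=
  T.H a x * Q.trans a b x - P.trans a b x * T.H b x

theorem mem_left (T : Comparison P Q) {a b x : X} (hx : x ∈ T.cover.nhd a ⊓ T.cover.nhd b) :
    x ∈ P.cover.nhd a ⊓ P.cover.nhd b := ⟨T.refines_left a hx.1, T.refines_left b hx.2⟩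

theorem mem_right (T : Comparison P Q) {a b x : X} (hx : x ∈ T.cover.nhd a ⊓ T.cover.nhd b) :
    x ∈ Q.cover.nhd a ⊓ Q.cover.nhd b := ⟨T.refines_right a hx.1, T.refines_right b hx.2⟩

theorem regular_defect (T : Comparison P Q) {a b x : X}
    (hx : x ∈ T.cover.nhd a ⊓ T.cover.nhd b) : RegularMatrix ι r (T.defect a b) x :=
  ((T.regular a x hx.1).mul (Q.regular a b x (T.mem_right hx))).sub
    (RegularMatrix.mul (M := P.trans a b) (P.regular a b x (T.mem_left hx)) (T.regular b x hx.2))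

theorem valueMatrix_defect (T : Comparison P Q) {a b x : X}
    (hx : x ∈ T.cover.nhd a ⊓ T.cover.nhd b) : valueMatrix (T.defect a b x) = 0 := by
  rw [defect, valueMatrix_sub, valueMatrix_mul, valueMatrix_mul, T.value_eq a x hx.1,
    T.value_eq b x hx.2, P.valueMatrix_trans (T.mem_left hx), Q.valueMatrix_trans (T.mem_right hx),
    matrixIn_mul, matrixIn_mul, sub_self]

variable [IsManifold 𝓘(ℂ, EX) ω X] [IsManifold 𝓘(ℂ, EY) ω Y] [VectorBundle ℂ (Fin r → ℂ) E]
  [∀ x, IsTopologicalAddGroup (E x)] [∀ x, ContinuousSMul ℂ (E x)]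

/-- The cocycle which measures the failure of the local isomorphisms to agree. -/
noncomputable def cocycle (T : Comparison P Q) : cocycles (conormalSheaf ι r E) T.cover :=
  ⟨fun a b => differentialForm (P.frame a) (Q.frame b) (T.defect a b), fun a b =>
    differentialForm_mem_conormalSheaf
      (fun x hx => P.isHolomorphicFrame (T.mem_left hx).1)
      (fun x hx => Q.isHolomorphicFrame (T.mem_right hx).2)
      (fun x hx => T.regular_defect hx) (fun x hx => T.valueMatrix_defect hx),
    fun a b d x hx => by
      have hab : x ∈ T.cover.nhd a ⊓ T.cover.nhd b := hx.1
      have hbd : x ∈ T.cover.nhd b ⊓ T.cover.nhd d := ⟨hx.1.2, hx.2⟩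
      have e : T.defect a d x =
          T.defect a b x * Q.trans b d x + P.trans a b x * T.defect b d x := by
        rw [defect, defect, defect,
          ← P.trans_mul a b d x ⟨T.mem_left hab, (T.mem_left hbd).2⟩,
          ← Q.trans_mul a b d x ⟨T.mem_right hab, (T.mem_right hbd).2⟩]
        noncomm_ring
      refine ContinuousLinearMap.ext fun v => matrixIn_injective (P.frame a x) (Q.frame d x) ?_
      rw [add_apply, matrixIn_add, matrixIn_differentialForm, e, differentialMatrix_add,
        differentialMatrix_mul, differentialMatrix_mul, T.valueMatrix_defect hab,
        T.valueMatrix_defect hbd, zero_mul, zero_add, mul_zero, add_zero,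
        ← matrixIn_differentialForm (P.frame a) (Q.frame b),
        ← matrixIn_differentialForm (P.frame b) (Q.frame d),
        P.valueMatrix_trans (T.mem_left hab), Q.valueMatrix_trans (T.mem_right hbd),
        matrixIn_right, matrixIn_left]⟩

theorem matrixIn_cocycle (T : Comparison P Q) (a b x : X)
    (v : TangentSpace 𝓘(ℂ, EY) (ι x)) :
    matrixIn (P.frame a x) (Q.frame b x) (T.cocycle.1 a b x v) =
      differentialMatrix v (T.defect a b x) :=
  matrixIn_differentialForm _ _ _ _ _

/-- The composition of comparisons. -/
noncomputable def comp (T : Comparison P Q) (T' : Comparison Q R) : Comparison P R where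
  cover := T.cover.inf T'.cover
  refines_left a := inf_le_left.trans (T.refines_left a)
  refines_right a := inf_le_right.trans (T'.refines_right a)
  H a x := T.H a x * T'.H a x
  regular a x hx := (T.regular a x hx.1).mul (T'.regular a x hx.2)
  value_eq a x hx := by
    rw [valueMatrix_mul, T.value_eq a x hx.1, T'.value_eq a x hx.2, matrixIn_mul]

theorem mk_cocycle_comp (T : Comparison P Q) (T' : Comparison Q R) :
    H1.mk (T.comp T').cocycle = H1.mk T.cocycle + H1.mk T'.cocycle := by
  rw [← H1.mk_restrictCocycle (PointCover.inf_left T.cover T'.cover) T.cocycle,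
    ← H1.mk_restrictCocycle (PointCover.inf_right T.cover T'.cover) T'.cocycle, ← H1.mk_add]
  refine H1.mk_eq_of_eq _ _ (T.cover.inf T'.cover) fun a b x hx => ?_
  have hT : x ∈ T.cover.nhd a ⊓ T.cover.nhd b := ⟨hx.1.1, hx.2.1⟩
  have hT' : x ∈ T'.cover.nhd a ⊓ T'.cover.nhd b := ⟨hx.1.2, hx.2.2⟩
  have e : (T.comp T').defect a b x =
      T.defect a b x * T'.H b x + T.H a x * T'.defect a b x := by
    simp only [defect, comp]
    noncomm_ring
  refine ContinuousLinearMap.ext fun v => matrixIn_injective (P.frame a x) (R.frame b x) ?_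
  change _ = matrixIn _ _ (T.cocycle.1 a b x v + T'.cocycle.1 a b x v)
  rw [matrixIn_cocycle, e, differentialMatrix_add, differentialMatrix_mul, differentialMatrix_mul,
    T.valueMatrix_defect hT, T'.valueMatrix_defect hT', zero_mul, zero_add, mul_zero, add_zero,
    ← matrixIn_cocycle, ← matrixIn_cocycle, T.value_eq a x hT.1, T'.value_eq b x hT'.2,
    matrixIn_right, matrixIn_left, matrixIn_add]

theorem mk_cocycle_self (T : Comparison P P) : H1.mk T.cocycle = 0 := by
  have hv : ∀ a, ∀ x ∈ T.cover.nhd a, valueMatrix (T.H a x - 1) = 0 := fun a x hx => by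
    rw [valueMatrix_sub, T.value_eq a x hx, matrixIn_self, valueMatrix_one, sub_self]
  obtain ⟨s, hs⟩ : ∃ s : X → ∀ x, FormFiber ι E x, ∀ c,
      s c = differentialForm (P.frame c) (P.frame c) fun z => T.H c z - 1 := ⟨_, fun _ => rfl⟩
  rw [← H1.mk_zero (U := T.cover)]
  refine H1.mk_eq_of_sub _ _ T.cover s (fun a => ?_) fun a b x hx => ?_
  · rw [hs]
    exact differentialForm_mem_conormalSheaf
      (fun x hx => P.isHolomorphicFrame (T.refines_left a hx))
      (fun x hx => P.isHolomorphicFrame (T.refines_left a hx))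
      (fun x hx => (T.regular a x hx).sub .one) (hv a)
  have hd : ∀ c v, differentialMatrix v (T.H c x - 1) =
      matrixIn (P.frame c x) (P.frame c x) (s c x v) := fun c v => by
    rw [hs]
    exact (matrixIn_differentialForm (P.frame c) (P.frame c) (fun z => T.H c z - 1) x v).symm
  have e : T.defect a b x = (T.H a x - 1) * P.trans a b x - P.trans a b x * (T.H b x - 1) := by
    simp only [defect]
    noncomm_ring
  refine (sub_zero _).trans <| ContinuousLinearMap.ext fun v =>
    matrixIn_injective (P.frame a x) (P.frame b x) ?_
  rw [matrixIn_cocycle, e, differentialMatrix_sub, differentialMatrix_mul, differentialMatrix_mul,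
    hv a x hx.1, hv b x hx.2, zero_mul, zero_add, mul_zero, add_zero, hd a, hd b,
    P.valueMatrix_trans (T.mem_left hx), matrixIn_right, matrixIn_left, sub_apply, matrixIn_sub]

theorem exists_of_isomorphic (h : P.Isomorphic Q) :
    ∃ T : Comparison P Q, H1.mk T.cocycle = 0 := by
  obtain ⟨W, H, K, hP, hQ, hH, -, -, hc, hv⟩ := h
  refine ⟨⟨W, hP, hQ, H, hH, hv⟩, ?_⟩
  rw [← H1.mk_zero (U := W)]
  refine H1.mk_eq_of_eq _ _ W fun a b x hx => ?_
  refine ContinuousLinearMap.ext fun v => matrixIn_injective (P.frame a x) (Q.frame b x) ?_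
  rw [matrixIn_cocycle, defect, hc a b x hx, sub_self, differentialMatrix_zero]
  exact (matrixIn_zero _ _).symm

omit [IsManifold 𝓘(ℂ, EX) ω X] in
theorem nonempty (hι : Manifold.IsImmersion 𝓘(ℂ, EX) 𝓘(ℂ, EY) ω ι) (P Q : Extension ι r E) :
    Nonempty (Comparison P Q) := by
  choose M hM using fun a : X => exists_matrix_of_frames hι
    (P.isHolomorphicFrame (P.cover.mem_nhd a)) (Q.isHolomorphicFrame (Q.cover.mem_nhd a))
  choose N hN hNo haN using fun a : X => eventually_nhds_iff.1 (hM a)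
  exact ⟨⟨⟨fun a => ⟨N a, hNo a⟩ ⊓ (P.cover.nhd a ⊓ Q.cover.nhd a),
      fun a => ⟨haN a, P.cover.mem_nhd a, Q.cover.mem_nhd a⟩⟩,
    fun a => inf_le_right.trans inf_le_left, fun a => inf_le_right.trans inf_le_right, M,
    fun a x hx => (hN a x hx.1).1, fun a x hx => (hN a x hx.1).2⟩⟩

theorem isomorphic [FiniteDimensional ℂ EY] (hι : Manifold.IsImmersion 𝓘(ℂ, EX) 𝓘(ℂ, EY) ω ι)
    (T : Comparison P Q) (h : H1.mk T.cocycle = 0) : P.Isomorphic Q := by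
  obtain ⟨U, s, hs, hc⟩ := (H1.mk_eq_zero _).1 h
  choose S hS using fun a => exists_matrix_of_form hι (U := T.cover.nhd a ⊓ U.nhd a)
    (fun x hx => P.isHolomorphicFrame (T.refines_left a hx.1))
    (fun x hx => Q.isHolomorphicFrame (T.refines_right a hx.1))
    (sectionsOver_anti inf_le_right (hs a))
  let H : X → ∀ x, Matrix (Fin r) (Fin r) (Stalk ι x) := fun a x => T.H a x - S a x
  have hH : ∀ a, ∀ x ∈ T.cover.nhd a ⊓ U.nhd a, RegularMatrix ι r (H a) x := fun a x hx =>
    (T.regular a x hx.1).sub (hS a x hx).1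
  have hv : ∀ a, ∀ x ∈ T.cover.nhd a ⊓ U.nhd a, valueMatrix (H a x) =
      matrixIn (P.frame a x) (Q.frame a x) (.id ℂ (E x)) := fun a x hx => by
    rw [valueMatrix_sub, T.value_eq a x hx.1, (hS a x hx).2.1, sub_zero]
  have hdet : ∀ a, ∀ x ∈ T.cover.nhd a ⊓ U.nhd a, (valueMatrix (H a x)).det ≠ 0 := by
    intro a x hx h0
    have h1 : valueMatrix (H a x) * matrixIn (Q.frame a x) (P.frame a x) (.id ℂ (E x)) = 1 := by
      rw [hv a x hx, matrixIn_mul, matrixIn_self]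
    have h2 := congrArg Matrix.det h1
    rw [Matrix.det_mul, h0, zero_mul, Matrix.det_one] at h2
    exact zero_ne_one h2
  refine ⟨T.cover.inf U, H, fun a x => (H a x)⁻¹, fun a => inf_le_left.trans (T.refines_left a),
    fun a => inf_le_left.trans (T.refines_right a), hH,
    fun a x hx => (hH a x hx).inv (hdet a x hx),
    fun a x hx => ⟨Matrix.mul_nonsing_inv _ (isUnit_det_of_value (hdet a x hx)),
      Matrix.nonsing_inv_mul _ (isUnit_det_of_value (hdet a x hx))⟩, fun a b x hx => ?_, hv⟩
  have e : ∀ z, H a z * Q.trans a b z - P.trans a b z * H b z =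
      T.defect a b z - S a z * Q.trans a b z + P.trans a b z * S b z := fun z => by
    simp only [H, defect]
    noncomm_ring
  symm
  rw [← sub_eq_zero]
  refine RegularMatrix.eq_zero (U := (T.cover.inf U).nhd a ⊓ (T.cover.inf U).nhd b) hι
    (M := fun z => H a z * Q.trans a b z - P.trans a b z * H b z)
    (fun z hz => ?_) (fun z hz => ?_) (fun z hz v => ?_) hx
  all_goals
    have hT : z ∈ T.cover.nhd a ⊓ T.cover.nhd b := ⟨hz.1.1, hz.2.1⟩
  · exact ((hH a z hz.1).mul (Q.regular a b z (T.mem_right hT))).sub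
      (RegularMatrix.mul (M := P.trans a b) (P.regular a b z (T.mem_left hT)) (hH b z hz.2))
  · rw [e, valueMatrix_add, valueMatrix_sub, valueMatrix_mul, valueMatrix_mul,
      T.valueMatrix_defect hT, (hS a z hz.1).2.1, (hS b z hz.2).2.1, zero_mul, mul_zero, sub_zero,
      add_zero]
  · rw [e, differentialMatrix_add, differentialMatrix_sub, differentialMatrix_mul,
      differentialMatrix_mul, (hS a z hz.1).2.1, (hS b z hz.2).2.1, zero_mul, mul_zero, zero_add,
      add_zero, (hS a z hz.1).2.2, (hS b z hz.2).2.2, P.valueMatrix_trans (T.mem_left hT),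
      Q.valueMatrix_trans (T.mem_right hT), matrixIn_left, matrixIn_right, ← matrixIn_cocycle,
      hc a b z ⟨hz.1.2, hz.2.2⟩, ← matrixIn_sub, ← matrixIn_add, ← matrixIn_zero (P.frame a z)
      (Q.frame b z)]
    congr 1
    rw [sub_apply]
    abel

end Comparison

end Comparison

section Translate

variable {EX EY : Type*} [NormedAddCommGroup EX] [NormedSpace ℂ EX]
  [NormedAddCommGroup EY] [NormedSpace ℂ EY]
  {X Y : Type*} [TopologicalSpace X] [ChartedSpace EX X]
  [TopologicalSpace Y] [ChartedSpace EY Y]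
  {ι : C^ω⟮𝓘(ℂ, EX), X; 𝓘(ℂ, EY), Y⟯} {r : ℕ}
  {E : X → Type*} [∀ x, AddCommGroup (E x)] [∀ x, Module ℂ (E x)] [∀ x, TopologicalSpace (E x)]
  [TopologicalSpace (TotalSpace (Fin r → ℂ) E)] [FiberBundle (Fin r → ℂ) E]

/-- The restriction of the transition functions to a finer cover. -/
noncomputable def Extension.restrict (P : Extension ι r E) {W : PointCover X}
    (h : W.Refines P.cover) : Extension ι r E where
  cover := W
  trans := P.trans
  regular a b x hx := P.regular a b x ⟨h a hx.1, h b hx.2⟩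
  trans_self a x hx := P.trans_self a x (h a hx)
  trans_mul a b c x hx := P.trans_mul a b c x ⟨⟨h a hx.1.1, h b hx.1.2⟩, h c hx.2⟩
  frame := P.frame
  frame_holomorphic a x hx := P.frame_holomorphic a x (h a hx)
  g_eq a b x hx := P.g_eq a b x ⟨h a hx.1, h b hx.2⟩

theorem Extension.restrict_isomorphic (P : Extension ι r E) {W : PointCover X}
    (h : W.Refines P.cover) : (P.restrict h).Isomorphic P :=
  ⟨W, fun _ _ => 1, fun _ _ => 1, fun _ => le_rfl, h,
    fun _ _ _ => regular_one, fun _ _ _ => regular_one, by simp,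
    fun a b x _ => (mul_one _).trans (one_mul _).symm,
    fun a x _ => valueMatrix_one.trans (matrixIn_self _).symm⟩

theorem Extension.differentialMatrix_trans_self (P : Extension ι r E) {a x : X}
    (hx : x ∈ P.cover.nhd a) (v : TangentSpace 𝓘(ℂ, EY) (ι x)) :
    differentialMatrix v (P.trans a a x) = 0 := by
  rw [P.trans_self a x hx, differentialMatrix_one]

variable [IsManifold 𝓘(ℂ, EX) ω X] [IsManifold 𝓘(ℂ, EY) ω Y] [VectorBundle ℂ (Fin r → ℂ) E]
  [∀ x, IsTopologicalAddGroup (E x)] [∀ x, ContinuousSMul ℂ (E x)]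

/-! ### The difference of two extensions -/

/-- The class of `Q` relative to `P`. -/
noncomputable def difference (hι : Manifold.IsImmersion 𝓘(ℂ, EX) 𝓘(ℂ, EY) ω ι)
    (P Q : Extension ι r E) : H1 (conormalSheaf ι r E) :=
  H1.mk (Comparison.nonempty hι P Q).some.cocycle

variable {hι : Manifold.IsImmersion 𝓘(ℂ, EX) 𝓘(ℂ, EY) ω ι}

theorem Comparison.mk_cocycle_eq (hι : Manifold.IsImmersion 𝓘(ℂ, EX) 𝓘(ℂ, EY) ω ι)
    {P Q : Extension ι r E} (T T' : Comparison P Q) : H1.mk T.cocycle = H1.mk T'.cocycle := by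
  obtain ⟨S⟩ := Comparison.nonempty hι Q P
  have h := (mk_cocycle_comp T S).symm.trans (mk_cocycle_self _)
  have h' := (mk_cocycle_comp T' S).symm.trans (mk_cocycle_self _)
  exact add_right_cancel (h.trans h'.symm)

theorem Comparison.difference_eq {P Q : Extension ι r E} (T : Comparison P Q) :
    difference hι P Q = H1.mk T.cocycle :=
  mk_cocycle_eq hι _ _

theorem difference_add (P Q R : Extension ι r E) :
    difference hι P Q + difference hι Q R = difference hι P R := by
  obtain ⟨T⟩ := Comparison.nonempty hι P Q
  obtain ⟨T'⟩ := Comparison.nonempty hι Q R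
  rw [T.difference_eq, T'.difference_eq, (T.comp T').difference_eq, Comparison.mk_cocycle_comp]

theorem difference_eq_zero_iff [FiniteDimensional ℂ EY] {P Q : Extension ι r E} :
    difference hι P Q = 0 ↔ P.Isomorphic Q := by
  constructor
  · exact fun h => Comparison.isomorphic hι _ h
  · intro h
    obtain ⟨T, hT⟩ := Comparison.exists_of_isomorphic h
    rw [T.difference_eq, hT]

theorem difference_congr [FiniteDimensional ℂ EY] {P P' Q Q' : Extension ι r E}
    (h : P.Isomorphic P') (h' : Q.Isomorphic Q') :
    difference hι P Q = difference hι P' Q' := by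
  rw [← difference_add P P' Q, ← difference_add P' Q' Q, difference_eq_zero_iff.2 h,
    difference_eq_zero_iff.2 h'.symm, zero_add, add_zero]

/-- Adding conormal forms to the differentials of the transition functions gives an extension. -/
theorem Extension.exists_add_cocycle [FiniteDimensional ℂ EY]
    (hι : Manifold.IsImmersion 𝓘(ℂ, EX) 𝓘(ℂ, EY) ω ι) (P : Extension ι r E)
    (C : cocycles (conormalSheaf ι r E) P.cover) :
    ∃ Q : Extension ι r E, Q.cover = P.cover ∧ Q.frame = P.frame ∧
      ∀ i j, ∀ x ∈ P.cover.nhd i ⊓ P.cover.nhd j, ∀ v,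
        differentialMatrix v (Q.trans i j x) = differentialMatrix v (P.trans i j x) +
          matrixIn (P.frame i x) (P.frame j x) (C.1 i j x v) := by
  choose S hS using fun a b => exists_matrix_of_form hι (U := P.cover.nhd a ⊓ P.cover.nhd b)
    (fun x hx => P.isHolomorphicFrame (a := a) hx.1)
    (fun x hx => P.isHolomorphicFrame (a := b) hx.2) (C.2.1 a b)
  have hself : ∀ a, ∀ x ∈ P.cover.nhd a, S a a x = 0 := fun a x hx => by
    refine RegularMatrix.eq_zero hι (U := P.cover.nhd a) (fun z hz => (hS a a z ⟨hz, hz⟩).1)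
      (fun z hz => (hS a a z ⟨hz, hz⟩).2.1) (fun z hz v => ?_) hx
    rw [(hS a a z ⟨hz, hz⟩).2.2, cocycle_self C hz]
    exact matrixIn_zero _ _
  have hmul : ∀ a b c, ∀ x ∈ P.cover.nhd a ⊓ P.cover.nhd b ⊓ P.cover.nhd c,
      P.trans a b x * S b c x + S a b x * P.trans b c x + S a b x * S b c x - S a c x = 0 :=
    fun a b c x hx => by
    refine RegularMatrix.eq_zero hι (U := P.cover.nhd a ⊓ P.cover.nhd b ⊓ P.cover.nhd c)
      (M := fun z => P.trans a b z * S b c z + S a b z * P.trans b c z + S a b z * S b c z -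
        S a c z) (fun z hz => ?_) (fun z hz => ?_) (fun z hz v => ?_) hx
    all_goals
      have hab := hS a b z hz.1
      have hbc := hS b c z ⟨hz.1.2, hz.2⟩
      have hac := hS a c z ⟨hz.1.1, hz.2⟩
      have gab := P.valueMatrix_trans (a := a) (b := b) hz.1
      have gbc := P.valueMatrix_trans (a := b) (b := c) ⟨hz.1.2, hz.2⟩
    · have rab : RegularMatrix ι r (P.trans a b) z := P.regular a b z hz.1
      have rbc : RegularMatrix ι r (P.trans b c) z := P.regular b c z ⟨hz.1.2, hz.2⟩
      exact (((rab.mul hbc.1).add (hab.1.mul rbc)).add (hab.1.mul hbc.1)).sub hac.1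
    · rw [valueMatrix_sub, valueMatrix_add, valueMatrix_add, valueMatrix_mul, valueMatrix_mul,
        valueMatrix_mul, hab.2.1, hbc.2.1, hac.2.1]
      simp
    · rw [differentialMatrix_sub, differentialMatrix_add, differentialMatrix_add,
        differentialMatrix_mul, differentialMatrix_mul, differentialMatrix_mul, hab.2.1, hbc.2.1,
        gab, gbc, hab.2.2, hbc.2.2, hac.2.2, mul_zero, add_zero, zero_mul, zero_add, zero_mul,
        mul_zero, add_zero, add_zero, matrixIn_left, matrixIn_right, ← C.2.2 a b c z hz,
        add_apply, matrixIn_add, add_comm, sub_self]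
  refine ⟨⟨⟨P.cover, fun a b x => P.trans a b x + S a b x, fun a b x hx =>
      RegularMatrix.add (M := P.trans a b) (P.regular a b x hx) (hS a b x hx).1,
    fun a x hx => ?_, fun a b c x hx => ?_⟩, P.frame, P.frame_holomorphic, fun a b x hx => ?_⟩,
    rfl, rfl, fun i j x hx v => ?_⟩
  · rw [hself a x hx, add_zero, P.trans_self a x hx]
  · rw [← P.trans_mul a b c x hx, ← sub_eq_zero, ← hmul a b c x hx]
    noncomm_ring
  · change valueMatrix (P.trans a b x + S a b x) = _
    rw [valueMatrix_add, (hS a b x hx).2.1, add_zero, P.valueMatrix_trans hx]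
  · rw [← (hS i j x hx).2.2]
    exact differentialMatrix_add _ _ _

theorem exists_isTranslate [FiniteDimensional ℂ EY]
    (hι : Manifold.IsImmersion 𝓘(ℂ, EX) 𝓘(ℂ, EY) ω ι)
    (P : Extension ι r E) (γ : H1 (conormalSheaf ι r E)) :
    ∃ Q : Extension ι r E, IsTranslate ⟦P⟧ γ ⟦Q⟧ := by
  obtain ⟨U, C, rfl⟩ := H1.exists_mk_eq γ
  obtain ⟨Q, hc, hf, hQ⟩ := (P.restrict (P.cover.inf_left U)).exists_add_cocycle hι
    (restrictCocycle (P.cover.inf_right U) C)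
  refine ⟨Q, P.restrict (P.cover.inf_left U), Q,
    Quotient.sound (P.restrict_isomorphic _), rfl, hc, hf, restrictCocycle (P.cover.inf_right U) C,
    H1.mk_restrictCocycle _ _, fun i j l x hx v => ?_⟩
  refine (hQ i j x hx.1 v).trans (congrArg _ ?_)
  rw [(P.restrict _).g_eq i l x ⟨hx.1.1, hx.2⟩, (P.restrict _).g_eq l j x ⟨hx.2, hx.1.2⟩,
    matrixIn_change]

theorem difference_of_differentials {P Q : Extension ι r E} (hc : Q.cover = P.cover)
    (hf : Q.frame = P.frame) (C : cocycles (conormalSheaf ι r E) P.cover)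
    (h : ∀ i j, ∀ x ∈ P.cover.nhd i ⊓ P.cover.nhd j, ∀ v,
        differentialMatrix v (Q.trans i j x) = differentialMatrix v (P.trans i j x) +
          matrixIn (P.frame i x) (P.frame j x) (C.1 i j x v)) :
    difference hι P Q = H1.mk C := by
  let T : Comparison P Q := ⟨P.cover, fun _ => le_rfl, fun a => by rw [hc], fun _ _ => 1,
    fun _ _ _ => .one, fun a x _ => by rw [hf, valueMatrix_one, matrixIn_self]⟩
  rw [T.difference_eq]
  refine H1.mk_eq_of_eq _ _ P.cover fun a b x hx => ?_
  refine ContinuousLinearMap.ext fun v => matrixIn_injective (P.frame a x) (Q.frame b x) ?_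
  have e : T.defect a b x = Q.trans a b x - P.trans a b x := by
    change 1 * _ - _ * 1 = _
    rw [one_mul, mul_one]
  rw [T.matrixIn_cocycle, e, differentialMatrix_sub, h a b x hx, add_sub_cancel_left, hf]

theorem isTranslate_iff [FiniteDimensional ℂ EY] {P Q : Extension ι r E}
    {γ : H1 (conormalSheaf ι r E)} :
    IsTranslate ⟦P⟧ γ ⟦Q⟧ ↔ difference hι P Q = γ := by
  have key : ∀ P Q : Extension ι r E, IsTranslate ⟦P⟧ γ ⟦Q⟧ → difference hι P Q = γ := by
    rintro P Q ⟨P', Q', hP, hQ, hc, hf, C, rfl, h⟩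
    rw [← difference_congr (Quotient.exact hP) (Quotient.exact hQ)]
    refine difference_of_differentials hc hf C fun i j x hx v => ?_
    refine (h i j i x ⟨hx, hx.1⟩ v).trans (congrArg _ ?_)
    rw [P'.g_eq i i x ⟨hx.1, hx.1⟩, P'.g_eq i j x hx, matrixIn_change]
  refine ⟨key P Q, fun h => ?_⟩
  obtain ⟨Q', hQ'⟩ := exists_isTranslate hι P γ
  have h0 : difference hι Q' Q = 0 := by
    have h1 := difference_add (hι := hι) P Q' Q
    rw [key P Q' hQ', h] at h1
    exact add_eq_left.1 h1
  have h1 : (⟦Q'⟧ : ExtensionClass ι r E) = ⟦Q⟧ := Quotient.sound (difference_eq_zero_iff.1 h0)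
  rwa [← h1]

/-! ### The Atiyah class -/

/-- The cocycle of the differentials of the transition functions. -/
noncomputable def Extension.atiyahCocycle (P : Extension ι r E) :
    cocycles (formSheaf ι r E) P.cover :=
  ⟨fun a b => differentialForm (P.frame a) (P.frame b) (P.trans a b),
    fun a b => mem_sectionsOver.2 fun x hx => differentialForm_mem_formSheaf
      (P.isHolomorphicFrame hx.1) (P.isHolomorphicFrame hx.2) (P.regular a b x hx),
    fun a b c x hx => by
      refine ContinuousLinearMap.ext fun v => matrixIn_injective (P.frame a x) (P.frame c x) ?_
      rw [add_apply, matrixIn_add, matrixIn_differentialForm, ← P.trans_mul a b c x hx,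
        differentialMatrix_mul, P.valueMatrix_trans hx.1, P.valueMatrix_trans ⟨hx.1.2, hx.2⟩,
        ← matrixIn_differentialForm (P.frame a) (P.frame b) (P.trans a b),
        ← matrixIn_differentialForm (P.frame b) (P.frame c) (P.trans b c), matrixIn_left,
        matrixIn_right, add_comm]⟩

theorem Extension.matrixIn_atiyahCocycle (P : Extension ι r E) (a b x : X)
    (v : TangentSpace 𝓘(ℂ, EY) (ι x)) :
    matrixIn (P.frame a x) (P.frame b x) (P.atiyahCocycle.1 a b x v) =
      differentialMatrix v (P.trans a b x) :=
  matrixIn_differentialForm _ _ _ _ _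

theorem Extension.isAtiyahClass_iff (P : Extension ι r E) {a : H1 (formSheaf ι r E)} :
    P.IsAtiyahClass a ↔ H1.mk P.atiyahCocycle = a := by
  constructor
  · rintro ⟨A, rfl, h⟩
    refine H1.mk_eq_of_eq _ _ P.cover fun i j x hx => ?_
    refine ContinuousLinearMap.ext fun v => matrixIn_injective (P.frame i x) (P.frame j x) ?_
    have h1 : matrixIn (P.frame i x) (P.frame i x) (A.1 i j x v) =
        valueMatrix (P.trans i i x) * differentialMatrix v (P.trans i i x) -
          valueMatrix (P.trans i j x) * differentialMatrix v (P.trans j i x) :=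
      h i j i x ⟨hx, hx.1⟩ v
    have h2 : differentialMatrix v (P.trans i j x * P.trans j i x) = 0 := by
      rw [P.trans_mul i j i x ⟨hx, hx.1⟩, P.differentialMatrix_trans_self hx.1]
    rw [differentialMatrix_mul] at h2
    have h3 : matrixIn (P.frame i x) (P.frame i x) (A.1 i j x v) =
        differentialMatrix v (P.trans i j x) * valueMatrix (P.trans j i x) := by
      rw [h1, P.differentialMatrix_trans_self hx.1, mul_zero, zero_sub]
      exact neg_eq_of_add_eq_zero_right h2
    rw [matrixIn_atiyahCocycle, ← matrixIn_right (P.frame i x) (P.frame i x), h3, mul_assoc,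
      ← P.valueMatrix_trans hx, ← valueMatrix_mul, P.trans_mul j i j x ⟨⟨hx.2, hx.1⟩, hx.2⟩,
      P.trans_self j x hx.2, valueMatrix_one, mul_one]
  · rintro rfl
    refine ⟨P.atiyahCocycle, rfl, fun i j l x hx v => ?_⟩
    have hj : x ∈ P.cover.nhd l ⊓ P.cover.nhd j := ⟨hx.2, hx.1.2⟩
    have hi : x ∈ P.cover.nhd l ⊓ P.cover.nhd i := ⟨hx.2, hx.1.1⟩
    change _ = valueMatrix (P.trans l i x) * differentialMatrix v (P.trans i l x) -
      valueMatrix (P.trans l j x) * differentialMatrix v (P.trans j l x)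
    rw [P.valueMatrix_trans hi, P.valueMatrix_trans hj, ← matrixIn_atiyahCocycle,
      ← matrixIn_atiyahCocycle, matrixIn_left, matrixIn_left, ← matrixIn_sub,
      ← P.atiyahCocycle.2.2 i j l x hx, add_apply, add_sub_cancel_right]

theorem conormalToForms_difference (P Q : Extension ι r E) :
    conormalToForms ι r E (difference hι P Q) + H1.mk P.atiyahCocycle =
      H1.mk Q.atiyahCocycle := by
  obtain ⟨T⟩ := Comparison.nonempty hι P Q
  obtain ⟨s, hs⟩ : ∃ s : X → ∀ x, FormFiber ι E x, ∀ c,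
      s c = differentialForm (P.frame c) (Q.frame c) (T.H c) := ⟨_, fun _ => rfl⟩
  rw [T.difference_eq, conormalToForms, H1.map_mk, ← H1.mk_restrictCocycle T.refines_left,
    ← H1.mk_add]
  refine H1.mk_eq_of_sub _ _ T.cover s (fun a => ?_) fun a b x hx => ?_
  · rw [hs]
    exact mem_sectionsOver.2 fun x hx => differentialForm_mem_formSheaf
      (P.isHolomorphicFrame (T.refines_left a hx)) (Q.isHolomorphicFrame (T.refines_right a hx))
      (T.regular a x hx)
  have hd : ∀ c v, differentialMatrix v (T.H c x) =
      matrixIn (P.frame c x) (Q.frame c x) (s c x v) := fun c v => by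
    rw [hs]
    exact (matrixIn_differentialForm (P.frame c) (Q.frame c) (T.H c) x v).symm
  refine ContinuousLinearMap.ext fun v => matrixIn_injective (P.frame a x) (Q.frame b x) ?_
  change matrixIn _ _ (T.cocycle.1 a b x v + P.atiyahCocycle.1 a b x v -
    Q.atiyahCocycle.1 a b x v) = matrixIn _ _ (s a x v - s b x v)
  rw [matrixIn_sub, matrixIn_add, matrixIn_sub, T.matrixIn_cocycle, Comparison.defect,
    differentialMatrix_sub, differentialMatrix_mul, differentialMatrix_mul, hd, hd,
    T.value_eq a x hx.1, T.value_eq b x hx.2, P.valueMatrix_trans (T.mem_left hx),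
    Q.valueMatrix_trans (T.mem_right hx), ← P.matrixIn_atiyahCocycle, ← Q.matrixIn_atiyahCocycle,
    matrixIn_left, matrixIn_left, matrixIn_right, matrixIn_right]
  abel

end Translate

end FirstOrderExtension

open FirstOrderExtension in
theorem proposition2
    {EX EY : Type*} [NormedAddCommGroup EX] [NormedSpace ℂ EX] [FiniteDimensional ℂ EX]
    [NormedAddCommGroup EY] [NormedSpace ℂ EY] [FiniteDimensional ℂ EY]
    {X Y : Type*}
    [TopologicalSpace X] [ChartedSpace EX X] [IsManifold 𝓘(ℂ, EX) ω X] [CompactSpace X]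
    [TopologicalSpace Y] [ChartedSpace EY Y] [IsManifold 𝓘(ℂ, EY) ω Y] [T2Space Y]
    (ι : C^ω⟮𝓘(ℂ, EX), X; 𝓘(ℂ, EY), Y⟯)
    (hι : Manifold.IsSmoothEmbedding 𝓘(ℂ, EX) 𝓘(ℂ, EY) ω ι)
    (r : ℕ) (E : X → Type*)
    [∀ x, AddCommGroup (E x)] [∀ x, Module ℂ (E x)] [∀ x, TopologicalSpace (E x)]
    [∀ x, IsTopologicalAddGroup (E x)] [∀ x, ContinuousSMul ℂ (E x)]
    [TopologicalSpace (TotalSpace (Fin r → ℂ) E)] [FiberBundle (Fin r → ℂ) E]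
    [VectorBundle ℂ (Fin r → ℂ) E] [ContMDiffVectorBundle ω (Fin r → ℂ) E 𝓘(ℂ, EX)]
    (e : ExtensionClass ι r E) :
    ∃ (At : ExtensionClass ι r E → H1 (formSheaf ι r E))
      (translate : H1 (conormalSheaf ι r E) → ExtensionClass ι r E),
      (∀ (P : Extension ι r E) (a : H1 (formSheaf ι r E)), P.IsAtiyahClass a ↔ At ⟦P⟧ = a) ∧
      (∀ (γ : H1 (conormalSheaf ι r E)) (e' : ExtensionClass ι r E),
        IsTranslate e γ e' ↔ translate γ = e') ∧
      Function.Bijective translate ∧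
      ∀ γ, At (translate γ) - At e = conormalToForms ι r E γ := by
  have hi := hι.isImmersion
  have hAt : ∀ P Q : Extension ι r E, P.Isomorphic Q →
      H1.mk P.atiyahCocycle = H1.mk Q.atiyahCocycle := fun P Q h => by
    rw [← conormalToForms_difference (hι := hi) P Q, difference_eq_zero_iff.2 h, map_zero, zero_add]
  obtain ⟨P, rfl⟩ := Quotient.exists_rep e
  choose Q hQ using exists_isTranslate hi P
  have hd : ∀ γ, difference hi P (Q γ) = γ := fun γ => isTranslate_iff.1 (hQ γ)
  have htr : ∀ γ e', IsTranslate ⟦P⟧ γ e' ↔ ⟦Q γ⟧ = e' := by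
    intro γ e'
    obtain ⟨R, rfl⟩ := Quotient.exists_rep e'
    rw [isTranslate_iff (hι := hi), Quotient.eq]
    change _ ↔ (Q γ).Isomorphic R
    rw [← difference_eq_zero_iff (hι := hi), ← difference_add P (Q γ) R, hd, add_eq_left]
  refine ⟨Quotient.lift (fun P => H1.mk P.atiyahCocycle) hAt, fun γ => ⟦Q γ⟧,
    fun P a => P.isAtiyahClass_iff, htr, ⟨fun γ γ' h => ?_, fun e' => ?_⟩, fun γ => ?_⟩
  · rw [← hd γ, ← hd γ']
    exact difference_congr (.refl P) (Quotient.exact h)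
  · obtain ⟨R, rfl⟩ := Quotient.exists_rep e'
    exact ⟨difference hi P R, (htr _ _).1 (isTranslate_iff.2 rfl)⟩
  · change H1.mk (Q γ).atiyahCocycle - H1.mk P.atiyahCocycle = _
    rw [← conormalToForms_difference (hι := hi) P (Q γ), hd, add_sub_cancel_right]
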